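/- **Theorem 1.4.** Let $q\in\mathbb{C}$ with $0<|q|<1$. Write $(a;q)_\infty=\prod_{k\ge 0}(1-aq^k)$, $(q)_\infty=(q;q)_\infty$, $\binom{n}{2}=\frac{n(n-1)}{2}$ for $n\in\mathbb{Z}$, and $$\Theta(x;q)=(x;q)_\infty(q/x;q)_\infty(q;q)_\infty .$$ Put $\mathrm{sg}(r)=1$ if $r\ge 0$, $\mathrm{sg}(r)=-1$ if $r<0$, and $\mathrm{sg}(r,s)=\frac{\mathrm{sg}(r)+\mathrm{sg}(s)}{2}$. For positive integers $a,b,c,d,e,f$ let $$f_{a,b,c}(x,y;q)=\sum_{r,s\in\mathbb{Z}}\mathrm{sg}(r,s)(-1)^{r+s}x^ry^sq^{a\binom r2+brs+c\binom s2},$$ $$\mathfrak{g}_{a,b,c,d,e,f}(x,y,z;q)=\Big(\sum_{r,s,u\ge 0}+\sum_{r,s,u<0}\Big)(-1)^{r+s+u}x^ry^sz^uq^{a\binom r2+brs+c\binom s2+dru+esu+f\binom u2}.$$ For integers $t,m$ with $t\ge 1$ and $0\le m\le 3t-1$ let $$\ell_{t,m}(x;q)=\Big(\sum_{r,s\ge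 0}-\sum_{r,s<0}\Big)\frac{(-1)^rq^{\binom r2+3trs+3t(3t-1)\binom s2+(m+1)r+(\binom{3t}{2}+3t-1)s}\big(1-q^{(3t-2m)r+2\binom{3t-1}{2}s+\binom{3t-1}{2}}\big)}{1-xq^r}$$ and $$V_t^{(m)}(x;q)=\frac{1-x}{(q)_\infty^2}\,\ell_{t,m}(x;q).$$ Then for every $x\in\mathbb{C}\setminus\{0\}$ that is not an integral power of $q$, the series $\ell_{t,m}(x;q)$ and all the series $f$ and $\mathfrak{g}$ in the following identity converge absolutely, and $$\begin{aligned} V_t^{(m)}(x;q)={}&\frac{(1-x)(-1)^{t+1}q^{(1-m)(1-3t)}}{(q)_\infty^2}\,f_{1,3t,3t(3t-1)}\big(q^m,-q^{\binom{3t}{2}+3t-1};q\big)\\ &\quad\times\left(\frac{f_{1,1,3t}\big(x^{-1}q,(-1)^{t+1}q^{3tm-m+1};q\big)}{\Theta(x;q)}-\frac{x^{-1}f_{1,1,3t}\big(xq,(-1)^{t+1}q^{3tm-m+1};q\big)}{\Theta(x^{-1};q)}\right)\\ &+\frac{1-x}{(q)_\infty^2}\sum_{i=0}^{3t-2}(-1)^iq^{\binom{i+1}{2}+mi}\,\Theta\big(-q^{\binom{3t}{2}+3t-1+3ti};q^{3t(3t-1)}\big)\\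 &\quad\times\left(\frac{\mathfrak{g}_{1,1,3t,1,3t,1}\big(x^{-1}q,(-1)^{t+1}q^{3mt+1-m},q^{i+1};q\big)}{\Theta(x;q)}-\frac{x^{-1}\mathfrak{g}_{1,1,3t,1,3t,1}\big(xq,(-1)^{t+1}q^{3mt+1-m},q^{i+1};q\big)}{\Theta(x^{-1};q)}\right)\\ &-\frac{\Theta\big(-q^{\binom{3t-1}{2}};q^{3t(3t-1)}\big)}{(q)_\infty^2}. \end{aligned}$$ -/

import Mathlib

noncomputable section

namespace MixedFalseTheta

/-- The binomial coefficient `n (n - 1) / 2`, for every integer `n`. -/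
def binom2 (n : ℤ) : ℤ := n * (n - 1) / 2

/-- The integer division in `binom2` is exact. -/
theorem two_mul_binom2 (n : ℤ) : 2 * binom2 n = n * (n - 1) := by
  unfold binom2
  apply Int.mul_ediv_cancel'
  have h := (Int.even_mul_succ_self (n - 1)).two_dvd
  rwa [sub_add_cancel, mul_comm] at h

/-- The infinite `q`-Pochhammer symbol `(a; q)_∞ = ∏_{k ≥ 0} (1 - a q ^ k)`. -/
def qPoch (a q : ℂ) : ℂ := ∏' k : ℕ, (1 - a * q ^ k)

/-- `Θ(x; q) = (x; q)_∞ (q / x; q)_∞ (q; q)_∞`. -/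
def Theta (x q : ℂ) : ℂ := qPoch x q * qPoch (q / x) q * qPoch q q

/-- `sg(r) = 1` if `r ≥ 0`, and `-1` if `r < 0`. -/
def sg (r : ℤ) : ℂ := if 0 ≤ r then 1 else -1

/-- `sg(r, s) = (sg(r) + sg(s)) / 2`. -/
def sg2 (r s : ℤ) : ℂ := (sg r + sg s) / 2

/-- The summand, indexed by `(r, s)`, of the Hecke-type double sum `f_{a,b,c}(x, y; q)`. -/
def heckeTerm (a b c : ℤ) (x y q : ℂ) (p : ℤ × ℤ) : ℂ :=
  sg2 p.1 p.2 * (-1) ^ (p.1 + p.2) * x ^ p.1 * y ^ p.2 *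
    q ^ (a * binom2 p.1 + b * p.1 * p.2 + c * binom2 p.2)

/-- The Hecke-type double sum `f_{a,b,c}(x, y; q)`. -/
def hecke (a b c : ℤ) (x y q : ℂ) : ℂ := ∑' p : ℤ × ℤ, heckeTerm a b c x y q p

/-- The pairs `(r, s)` with `r, s ≥ 0`. -/
def nonnegPairs : Set (ℤ × ℤ) := {p | 0 ≤ p.1 ∧ 0 ≤ p.2}

/-- The pairs `(r, s)` with `r, s < 0`. -/
def negPairs : Set (ℤ × ℤ) := {p | p.1 < 0 ∧ p.2 < 0}

/-- The triples `(r, s, u)` with `r, s, u ≥ 0`. -/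
def nonnegTriples : Set (ℤ × ℤ × ℤ) := {p | 0 ≤ p.1 ∧ 0 ≤ p.2.1 ∧ 0 ≤ p.2.2}

/-- The triples `(r, s, u)` with `r, s, u < 0`. -/
def negTriples : Set (ℤ × ℤ × ℤ) := {p | p.1 < 0 ∧ p.2.1 < 0 ∧ p.2.2 < 0}

/-- The summand, indexed by `(r, s, u)`, of the triple sum `𝔤_{a,b,c,d,e,f}(x, y, z; q)`. -/
def tripleTerm (a b c d e f : ℤ) (x y z q : ℂ) (p : ℤ × ℤ × ℤ) : ℂ :=
  (-1) ^ (p.1 + p.2.1 + p.2.2) * x ^ p.1 * y ^ p.2.1 * z ^ p.2.2 *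
    q ^ (a * binom2 p.1 + b * p.1 * p.2.1 + c * binom2 p.2.1 + d * p.1 * p.2.2
      + e * p.2.1 * p.2.2 + f * binom2 p.2.2)

/-- The triple sum `𝔤_{a,b,c,d,e,f}(x, y, z; q)`. -/
def triple (a b c d e f : ℤ) (x y z q : ℂ) : ℂ :=
  (∑' p : nonnegTriples, tripleTerm a b c d e f x y z q p) +
    ∑' p : negTriples, tripleTerm a b c d e f x y z q p

/-- Absolute convergence of the two sums that make up `𝔤_{a,b,c,d,e,f}(x, y, z; q)`. -/
def TripleSummable (a b c d e f : ℤ) (x y z q : ℂ) : Prop :=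
  (Summable fun p : nonnegTriples => tripleTerm a b c d e f x y z q p) ∧
    Summable fun p : negTriples => tripleTerm a b c d e f x y z q p

/-- The summand, indexed by `(r, s)`, of the Hecke-Appell type series `ℓ_{t,m}(x; q)`. -/
def ellTerm (t m : ℤ) (x q : ℂ) (p : ℤ × ℤ) : ℂ :=
  (-1) ^ p.1 *
    q ^ (binom2 p.1 + 3 * t * p.1 * p.2 + 3 * t * (3 * t - 1) * binom2 p.2
      + (m + 1) * p.1 + (binom2 (3 * t) + 3 * t - 1) * p.2) *
    (1 - q ^ ((3 * t - 2 * m) * p.1 + 2 * binom2 (3 * t - 1) * p.2 + binom2 (3 * t - 1))) /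
    (1 - x * q ^ p.1)

/-- The Hecke-Appell type series `ℓ_{t,m}(x; q)`. -/
def ell (t m : ℤ) (x q : ℂ) : ℂ :=
  (∑' p : nonnegPairs, ellTerm t m x q p) - ∑' p : negPairs, ellTerm t m x q p

/-- Absolute convergence of the two sums that make up `ℓ_{t,m}(x; q)`. -/
def EllSummable (t m : ℤ) (x q : ℂ) : Prop :=
  (Summable fun p : nonnegPairs => ellTerm t m x q p) ∧
    Summable fun p : negPairs => ellTerm t m x q p

/-- `V_t^{(m)}(x; q) = (1 - x) / (q; q)_∞ ^ 2 * ℓ_{t,m}(x; q)`. -/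
def V (t m : ℤ) (x q : ℂ) : ℂ := (1 - x) / qPoch q q ^ 2 * ell t m x q

end MixedFalseTheta

end

/-!
Write `T = 3 t`. The factor `1 - q ^ L` in `ellTerm` splits `ℓ` into two series, which the
reflection `(r, s) ↦ (-r, -1 - s)` exchanges, together with `x ↔ x⁻¹`, up to the row `r = 0`;
that row is the theta function in the last summand of the identity (`hasSum_sg2_mul_ellTerm`). This
reduces the identity to an evaluation of `Θ(x; q) A(x)`, where
`A(x) = ∑ sg(r, s) e(r, s) / (1 - x q ^ r)` and `e` is `appellCoeff`; see `Theta_mul_appell`, which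
is applied at `x` and at `x⁻¹`.

The evaluation compares Laurent coefficients in `x`. By the Jacobi triple product
(`hasSum_thetaTerm`), `Θ(x; q) / (1 - x q ^ r)` has an explicit Laurent expansion on the punctured
plane whose coefficients involve the partial theta function
`P(n) = ∑_{u ≥ 0} (-1)^u q^{u(u-1)/2 + nu}` (`hasSum_Theta_div`), so the coefficients of
`Θ(x; q) A(x)` are, up to a theta coefficient, `G(k) = ∑ sg(r, s) e(r, s) P(k + r + 1)`
(`laurentCoeff`). On the other side, summing the triple series over `u` also produces values of `P`
(`triple_eq_tsum`), and the right-hand side becomes a sum over `s` of the terms `D(k + T s)` with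
`D(k) = C F + ∑_i B_i P(i + 1 + k)` (`recursionTerm`). Here `C` is an explicit constant, `F` is the
Hecke sum `f_{1,T,T(T-1)}`, and `B_i`, the sum of `e(i, s)` over all integers `s`, is a theta
function.

The two sides are linked by the recursion
`G(k) - (-1)^T q^{(T-1)m+1+k} G(k + T) = D(k)` (`laurentCoeff_recursion`). It holds because
`(r, s) ↦ (r - (T - 1), s + 1)` changes `e` by a monomial that fits `P(n) + q^n P(n + 1) = 1`, and
changes `sg(r, s)` only on the strip `0 ≤ r ≤ T - 2`, which contributes the `B_i`, and on the row
`s = -1`, which contributes zero unless `k = m - T`. As `0 ≤ m ≤ T - 1`, the exceptional index lies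
in `[-T, -1]` and is never met when the recursion is iterated upwards from `k ≥ 0` or downwards from
`k < 0`; the iteration converges since `G` is bounded (`laurentCoeff_eq_tsum`).
-/

namespace MixedFalseTheta

open Filter Topology

/-! ### Binomial coefficients and theta series -/

theorem binom2_add (m n : ℤ) : binom2 (m + n) = binom2 m + binom2 n + m * n := by
  have h1 := two_mul_binom2 (m + n)
  have h2 := two_mul_binom2 m
  have h3 := two_mul_binom2 n
  linarith

theorem binom2_zero : binom2 0 = 0 := by simp [binom2]

theorem binom2_one : binom2 1 = 0 := by simp [binom2]

theorem binom2_add_one (n : ℤ) : binom2 (n + 1) = binom2 n + n := by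
  rw [binom2_add, binom2_one]; ring

theorem binom2_neg (n : ℤ) : binom2 (-n) = binom2 n + n := by
  have h1 := two_mul_binom2 (-n)
  have h2 := two_mul_binom2 n
  linarith

/-- The general term `(-1)^n q^{n(n-1)/2} x^n` of the theta series. -/
noncomputable def thetaTerm (q x : ℂ) (n : ℤ) : ℂ := (-1) ^ n * q ^ binom2 n * x ^ n

theorem neg_one_zpow_norm (n : ℤ) : ‖(-1 : ℂ) ^ n‖ = 1 := by simp

theorem thetaTerm_add_one {q x : ℂ} (hq0 : q ≠ 0) (hx : x ≠ 0) (n : ℤ) :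
    thetaTerm q x (n + 1) = thetaTerm q x n * (-x * q ^ n) := by
  simp only [thetaTerm, binom2_add_one, zpow_add₀ hq0, zpow_add_one₀ hx,
    zpow_add_one₀ (neg_ne_zero.mpr one_ne_zero : (-1 : ℂ) ≠ 0)]
  ring

theorem thetaTerm_ne_zero {q x : ℂ} (hq0 : q ≠ 0) (hx : x ≠ 0) (n : ℤ) :
    thetaTerm q x n ≠ 0 := by
  simp [thetaTerm, zpow_ne_zero, hq0, hx]

theorem thetaTerm_neg {q x : ℂ} (hq0 : q ≠ 0) (hx : x ≠ 0) (n : ℤ) :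
    thetaTerm q x (-n) = thetaTerm q (q / x) n := by
  simp only [thetaTerm, binom2_neg, zpow_add₀ hq0, div_zpow, zpow_neg]
  rw [← inv_zpow, inv_neg_one]
  field_simp

theorem summable_thetaTerm_nat {q x : ℂ} (hq0 : q ≠ 0) (hq1 : ‖q‖ < 1) (hx : x ≠ 0) :
    Summable fun n : ℕ => ‖thetaTerm q x n‖ := by
  refine summable_of_ratio_test_tendsto_lt_one (l := 0) one_pos
    (.of_forall fun n => norm_ne_zero_iff.mpr (thetaTerm_ne_zero hq0 hx n)) ?_
  have h : Tendsto (fun n : ℕ => ‖x‖ * ‖q‖ ^ n) atTop (𝓝 0) := by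
    simpa using (tendsto_pow_atTop_nhds_zero_of_lt_one (norm_nonneg q) hq1).const_mul ‖x‖
  refine h.congr fun n => ?_
  have h0 := norm_ne_zero_iff.mpr (thetaTerm_ne_zero hq0 hx n)
  rw [norm_norm, norm_norm, Nat.cast_succ, thetaTerm_add_one hq0 hx, norm_mul]
  field_simp
  simp

theorem summable_thetaTerm {q x : ℂ} (hq0 : q ≠ 0) (hq1 : ‖q‖ < 1) (hx : x ≠ 0) :
    Summable fun n : ℤ => ‖thetaTerm q x n‖ := by
  refine .of_nat_of_neg (summable_thetaTerm_nat hq0 hq1 hx) ?_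
  simp only [thetaTerm_neg hq0 hx]
  exact summable_thetaTerm_nat hq0 hq1 (div_ne_zero hq0 hx)

/-! ### The Jacobi triple product -/

theorem one_sub_pow_succ_ne_zero {q : ℂ} (hq1 : ‖q‖ < 1) (n : ℕ) : 1 - q ^ (n + 1) ≠ 0 := by
  refine sub_ne_zero.mpr fun h => ?_
  have h1 : ‖q‖ ^ (n + 1) = 1 := by rw [← norm_pow, ← h, norm_one]
  exact (pow_lt_one₀ (norm_nonneg q) hq1 n.succ_ne_zero).ne h1

theorem summable_qPoch {q : ℂ} (hq1 : ‖q‖ < 1) (a : ℂ) :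
    Summable fun k : ℕ => ‖-(a * q ^ k)‖ := by
  simpa [norm_mul, norm_pow] using
    (summable_geometric_of_lt_one (norm_nonneg q) hq1).mul_left ‖a‖

theorem tendsto_qPoch {q : ℂ} (hq1 : ‖q‖ < 1) (a : ℂ) :
    Tendsto (fun n : ℕ => ∏ k ∈ Finset.range n, (1 - a * q ^ k)) atTop (𝓝 (qPoch a q)) := by
  simpa [qPoch, sub_eq_add_neg] using
    (multipliable_one_add_of_summable (summable_qPoch hq1 a)).hasProd.tendsto_prod_nat

theorem qPoch_ne_zero {q : ℂ} (hq1 : ‖q‖ < 1) {a : ℂ} (ha : ∀ k : ℕ, a * q ^ k ≠ 1) :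
    qPoch a q ≠ 0 := by
  have := tprod_one_add_ne_zero_of_summable (f := fun k : ℕ => -(a * q ^ k))
    (fun k => by rw [← sub_eq_add_neg]; exact sub_ne_zero.mpr (ha k).symm) (summable_qPoch hq1 a)
  simpa [qPoch, sub_eq_add_neg] using this

theorem qPoch_self_ne_zero {q : ℂ} (hq1 : ‖q‖ < 1) : qPoch q q ≠ 0 :=
  qPoch_ne_zero hq1 fun k h => one_sub_pow_succ_ne_zero hq1 k (by rw [pow_succ', h, sub_self])

theorem Theta_ne_zero {q x : ℂ} (hq0 : q ≠ 0) (hq1 : ‖q‖ < 1) (hx : ∀ n : ℤ, x ≠ q ^ n) :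
    Theta x q ≠ 0 := by
  refine mul_ne_zero (mul_ne_zero (qPoch_ne_zero hq1 fun k h => hx (-k) ?_)
    (qPoch_ne_zero hq1 fun k h => hx (k + 1) ?_)) (qPoch_self_ne_zero hq1)
  · rw [zpow_neg, zpow_natCast]
    exact eq_inv_of_mul_eq_one_left h
  · have hx0 : x ≠ 0 := fun h0 => by simp [h0] at h
    field_simp at h
    rw [zpow_add_one₀ hq0, zpow_natCast, ← h]
    ring

/-- The finite `q`-Pochhammer symbol `(q; q)_n`. -/
noncomputable def qFact (q : ℂ) (n : ℕ) : ℂ := ∏ k ∈ Finset.range n, (1 - q ^ (k + 1))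

theorem qFact_succ (q : ℂ) (n : ℕ) : qFact q (n + 1) = qFact q n * (1 - q ^ (n + 1)) :=
  Finset.prod_range_succ _ _

theorem qFact_ne_zero {q : ℂ} (hq1 : ‖q‖ < 1) (n : ℕ) : qFact q n ≠ 0 :=
  Finset.prod_ne_zero_iff.mpr fun k _ => one_sub_pow_succ_ne_zero hq1 k

theorem tendsto_qFact {q : ℂ} (hq1 : ‖q‖ < 1) :
    Tendsto (qFact q) atTop (𝓝 (qPoch q q)) := by
  refine (tendsto_qPoch hq1 q).congr fun n => ?_
  exact Finset.prod_congr rfl fun k _ => by rw [pow_succ']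

/-- `1 / (q; q)_n`, extended by zero to negative integers `n`. -/
noncomputable def invQFact (q : ℂ) (n : ℤ) : ℂ := if 0 ≤ n then (qFact q n.toNat)⁻¹ else 0

theorem invQFact_sub_one {q : ℂ} (hq1 : ‖q‖ < 1) (n : ℤ) :
    invQFact q (n - 1) = (1 - q ^ n) * invQFact q n := by
  rcases lt_trichotomy n 0 with h | rfl | h
  · rw [invQFact, invQFact, if_neg (by omega), if_neg (by omega), mul_zero]
  · simp [invQFact]
  · obtain ⟨k, rfl⟩ : ∃ k : ℕ, n = k + 1 := ⟨(n - 1).toNat, by omega⟩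
    have h1 := one_sub_pow_succ_ne_zero hq1 k
    have h2 := qFact_ne_zero hq1 k
    have h3 : ((k : ℤ) + 1).toNat = k + 1 := by omega
    rw [invQFact, invQFact, if_pos (by omega), if_pos (by omega), h3, add_sub_cancel_right,
      Int.toNat_natCast, qFact_succ]
    have h4 : q ^ ((k : ℤ) + 1) = q ^ (k + 1) := by exact_mod_cast zpow_natCast q (k + 1)
    rw [h4]
    field_simp

/-- The `q`-binomial coefficient `[2n choose n + j]`, zero unless `-n ≤ j ≤ n`. -/
noncomputable def centralQBinom (q : ℂ) (n : ℕ) (j : ℤ) : ℂ :=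
  qFact q (2 * n) * invQFact q (n + j) * invQFact q (n - j)

theorem centralQBinom_succ {q : ℂ} (hq0 : q ≠ 0) (hq1 : ‖q‖ < 1) (n : ℕ) (j : ℤ) :
    centralQBinom q (n + 1) j = (1 + q ^ (2 * n + 1)) * centralQBinom q n j
      + q ^ (n + 1 - j) * centralQBinom q n (j - 1)
      + q ^ (n + 1 + j) * centralQBinom q n (j + 1) := by
  set A := invQFact q (n + 1 + j) with hA
  set B := invQFact q (n + 1 - j) with hB
  set u := q ^ ((n : ℤ) + 1 + j) with hu
  set v := q ^ ((n : ℤ) + 1 - j) with hv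
  have huv : u * v = q ^ (2 * n + 2) := by
    rw [hu, hv, ← zpow_add₀ hq0, ← zpow_natCast]; congr 1; push_cast; ring
  have a1 : invQFact q (n + j) = (1 - u) * A := by
    rw [hA, hu, ← invQFact_sub_one hq1]; congr 1; ring
  have b1 : invQFact q (n - j) = (1 - v) * B := by
    rw [hB, hv, ← invQFact_sub_one hq1]; congr 1; ring
  have a2 : invQFact q (n + (j - 1)) = (1 - u / q) * ((1 - u) * A) := by
    rw [← a1, hu, div_eq_mul_inv, ← zpow_sub_one₀ hq0, show (n : ℤ) + 1 + j - 1 = n + j by ring,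
      ← invQFact_sub_one hq1]; congr 1; ring
  have b2 : invQFact q (n - (j + 1)) = (1 - v / q) * ((1 - v) * B) := by
    rw [← b1, hv, div_eq_mul_inv, ← zpow_sub_one₀ hq0, show (n : ℤ) + 1 - j - 1 = n - j by ring,
      ← invQFact_sub_one hq1]; congr 1; ring
  have a3 : invQFact q (n + (j + 1)) = A := by rw [hA]; congr 1; ring
  have b3 : invQFact q (n - (j - 1)) = B := by rw [hB]; congr 1; ring
  have e1 : q ^ (2 * n + 1) = u * v / q := by
    rw [huv, eq_div_iff hq0, ← pow_succ]
  have e2 : qFact q (2 * (n + 1)) = qFact q (2 * n) * (1 - u * v / q) * (1 - u * v) := by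
    rw [show 2 * (n + 1) = 2 * n + 1 + 1 by ring, qFact_succ, qFact_succ, e1,
      show 2 * n + 1 + 1 = 2 * n + 2 by ring, huv]
  rw [centralQBinom, centralQBinom, centralQBinom, centralQBinom, a1, b1, a2, b2, a3, b3, e1, e2,
    Nat.cast_succ, ← hA, ← hB]
  field_simp
  ring

/-- The finite form of the Jacobi triple product, as a bilateral sum with finitely many non-zero
terms. -/
theorem hasSum_finite_jacobi {q x : ℂ} (hq0 : q ≠ 0) (hq1 : ‖q‖ < 1) (hx : x ≠ 0) (n : ℕ) :
    HasSum (fun j : ℤ => centralQBinom q n j * thetaTerm q x j)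
      ((∏ k ∈ Finset.range n, (1 - x * q ^ k)) * ∏ k ∈ Finset.range n, (1 - q / x * q ^ k)) := by
  induction n with
  | zero =>
    convert! hasSum_single (f := fun j : ℤ => centralQBinom q 0 j * thetaTerm q x j) 0 ?_ using 1
    · simp [centralQBinom, invQFact, qFact, thetaTerm, binom2_zero]
    · intro j hj
      have : centralQBinom q 0 j = 0 := by
        rcases lt_or_gt_of_ne hj with h | h
        · simp [centralQBinom, invQFact, h.not_ge]
        · simp [centralQBinom, invQFact, h.not_ge]
      rw [this, zero_mul]
  | succ n ih =>
    have h1 := ih.mul_left (1 + q ^ (2 * n + 1))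
    have h2 := (((Equiv.subRight (1 : ℤ)).hasSum_iff).mpr ih).mul_left (-x * q ^ n)
    have h3 := (((Equiv.addRight (1 : ℤ)).hasSum_iff).mpr ih).mul_left (-(q / x) * q ^ n)
    convert! (h1.add h2).add h3 using 1
    · funext j
      have t1 : thetaTerm q x j = thetaTerm q x (j - 1) * (-x * q ^ (j - 1)) := by
        rw [← thetaTerm_add_one hq0 hx, sub_add_cancel]
      have t2 := thetaTerm_add_one hq0 hx j
      simp only [Function.comp_apply, Equiv.subRight_apply, Equiv.coe_addRight]
      rw [centralQBinom_succ hq0 hq1, t2, zpow_add₀ hq0, zpow_sub₀ hq0, add_mul, add_mul]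
      congr 1
      · congr 1
        · ring
        · rw [t1, zpow_sub_one₀ hq0, zpow_add_one₀ hq0, zpow_natCast]
          field_simp
      · rw [zpow_add_one₀ hq0, zpow_natCast]
        field_simp
    · rw [Finset.prod_range_succ, Finset.prod_range_succ]
      field_simp
      ring

theorem exists_bound_invQFact {q : ℂ} (hq1 : ‖q‖ < 1) :
    ∃ C : ℝ, ∀ n : ℤ, ‖invQFact q n‖ ≤ C := by
  obtain ⟨C, hC⟩ := ((tendsto_qFact hq1).inv₀ (qPoch_self_ne_zero hq1)).norm.bddAbove_range
  refine ⟨C, fun n => ?_⟩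
  have h := fun k : ℕ => hC (Set.mem_range_self k)
  unfold invQFact
  split_ifs
  · exact h _
  · simpa using (norm_nonneg _).trans (h 0)

theorem tendsto_invQFact {q : ℂ} (hq1 : ‖q‖ < 1) {u : ℕ → ℤ} (hu : Tendsto u atTop atTop) :
    Tendsto (fun n => invQFact q (u n)) atTop (𝓝 (qPoch q q)⁻¹) := by
  have h1 : Tendsto (fun n => (qFact q (u n).toNat)⁻¹) atTop (𝓝 (qPoch q q)⁻¹) :=
    ((tendsto_qFact hq1).inv₀ (qPoch_self_ne_zero hq1)).comp
      (tendsto_atTop.mpr fun b => (hu.eventually_ge_atTop (b : ℤ)).mono fun n hn => by omega)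
  refine h1.congr' ((hu.eventually_ge_atTop 0).mono fun n hn => ?_)
  simp only [invQFact, if_pos hn]

/-- The Jacobi triple product: the finite form is multiplied by `(q; q)_n`, after which the
coefficients are bounded and tend to `1`, so that Tannery's theorem applies. -/
theorem hasSum_thetaTerm {q x : ℂ} (hq0 : q ≠ 0) (hq1 : ‖q‖ < 1) (hx : x ≠ 0) :
    HasSum (thetaTerm q x) (Theta x q) := by
  have hs := summable_thetaTerm hq0 hq1 hx
  refine hs.of_norm.hasSum_iff.mpr ?_
  obtain ⟨C, hC⟩ := exists_bound_invQFact (q := q) hq1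
  obtain ⟨D, hD⟩ := (tendsto_qFact hq1).norm.bddAbove_range
  have hD' := fun k : ℕ => hD (Set.mem_range_self k)
  have hC0 : 0 ≤ C := (norm_nonneg _).trans (hC 0)
  have hD0 : 0 ≤ D := (norm_nonneg _).trans (hD' 0)
  have hne := qPoch_self_ne_zero hq1
  have hnat : Tendsto (fun n : ℕ => (n : ℤ)) atTop atTop := tendsto_natCast_atTop_atTop
  have lim1 : Tendsto (fun n : ℕ => ∑' j : ℤ, qFact q n * (centralQBinom q n j * thetaTerm q x j))
      atTop (𝓝 (∑' j, thetaTerm q x j)) := by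
    refine tendsto_tsum_of_dominated_convergence (hs.mul_left (D * (D * C * C)))
      (fun j => ?_) (.of_forall fun n j => ?_)
    · have h2n : Tendsto (fun n : ℕ => 2 * n) atTop atTop :=
        tendsto_id.const_mul_atTop' two_pos
      have := ((tendsto_qFact hq1).mul ((((tendsto_qFact hq1).comp h2n).mul
        (tendsto_invQFact hq1 (tendsto_atTop_add_const_right _ j hnat))).mul
        (tendsto_invQFact hq1 (tendsto_atTop_add_const_right _ (-j) hnat)))).mul_const
        (thetaTerm q x j)
      have hval : qPoch q q * (qPoch q q * (qPoch q q)⁻¹ * (qPoch q q)⁻¹) * thetaTerm q x j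
          = thetaTerm q x j := by field_simp
      rw [hval] at this
      refine this.congr fun n => ?_
      simp only [centralQBinom, Function.comp_apply, sub_eq_add_neg]
      ring
    · rw [norm_mul, norm_mul, centralQBinom, norm_mul, norm_mul, ← mul_assoc]
      gcongr
      exacts [hD' n, hD' _, hC _, hC _]
  have lim2 : Tendsto (fun n : ℕ => ∑' j : ℤ, qFact q n * (centralQBinom q n j * thetaTerm q x j))
      atTop (𝓝 (Theta x q)) := by
    have := ((tendsto_qPoch hq1 x).mul (tendsto_qPoch hq1 (q / x))).mul (tendsto_qFact hq1)
    refine this.congr fun n => ?_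
    rw [tsum_mul_left, (hasSum_finite_jacobi hq0 hq1 hx n).tsum_eq, mul_comm]
  exact tendsto_nhds_unique lim1 lim2

/-! ### Partial theta functions -/

/-- The theta series vanishes at integral powers of `q`. -/
theorem hasSum_thetaTerm_zpow {q : ℂ} (hq0 : q ≠ 0) (hq1 : ‖q‖ < 1) (n : ℤ) :
    HasSum (thetaTerm q (q ^ n)) 0 := by
  have hs := (summable_thetaTerm hq0 hq1 (zpow_ne_zero n hq0)).of_norm.hasSum
  -- The reflection `u ↦ 1 - 2n - u` fixes the exponent of `q` and changes the sign.
  have hrefl : thetaTerm q (q ^ n) ∘ Equiv.subLeft (1 - 2 * n) = -thetaTerm q (q ^ n) := by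
    funext u
    have hb : binom2 (1 - 2 * n - u) + n * (1 - 2 * n - u) = binom2 u + n * u := by
      have h1 := two_mul_binom2 (1 - 2 * n - u)
      have h2 := two_mul_binom2 u
      linarith
    have hsgn : (-1 : ℂ) ^ (1 - 2 * n - u) = -(-1) ^ u := by
      rw [zpow_sub₀ (by norm_num), zpow_sub₀ (by norm_num), zpow_mul]
      rcases u.even_or_odd with h | h
      · simp [h.neg_one_zpow]
      · simp [h.neg_one_zpow]
    simp only [thetaTerm, Function.comp_apply, Equiv.subLeft_apply, Pi.neg_apply]
    rw [mul_assoc, mul_assoc, ← zpow_mul, ← zpow_mul, ← zpow_add₀ hq0, ← zpow_add₀ hq0, hb, hsgn]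
    ring
  have h1 := (Equiv.subLeft (1 - 2 * n)).hasSum_iff.mpr hs
  rw [hrefl] at h1
  have h2 : (∑' u, thetaTerm q (q ^ n) u) = 0 := self_eq_neg.mp (h1.unique hs.neg)
  rwa [h2] at hs

/-- The partial theta function `∑_{u ≥ 0} (-1)^u q^{u(u-1)/2 + nu}`. -/
noncomputable def partialTheta (q : ℂ) (n : ℤ) : ℂ :=
  ∑' u : ℤ, if 0 ≤ u then thetaTerm q (q ^ n) u else 0

theorem hasSum_partialTheta {q : ℂ} (hq0 : q ≠ 0) (hq1 : ‖q‖ < 1) (n : ℤ) :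
    HasSum (fun u : ℤ => if 0 ≤ u then thetaTerm q (q ^ n) u else 0) (partialTheta q n) := by
  refine (Summable.of_norm_bounded (summable_thetaTerm hq0 hq1 (zpow_ne_zero n hq0))
    fun u => ?_).hasSum
  split_ifs <;> simp

theorem hasSum_partialTheta_neg {q : ℂ} (hq0 : q ≠ 0) (hq1 : ‖q‖ < 1) (n : ℤ) :
    HasSum (fun u : ℤ => if u < 0 then thetaTerm q (q ^ n) u else 0) (-partialTheta q n) := by
  convert! (hasSum_thetaTerm_zpow hq0 hq1 n).sub (hasSum_partialTheta hq0 hq1 n) using 1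
  · funext u
    by_cases h : 0 ≤ u
    · simp [h]
    · simp [h, not_le.mp h]
  · ring

theorem partialTheta_add {q : ℂ} (hq0 : q ≠ 0) (hq1 : ‖q‖ < 1) (n : ℤ) :
    partialTheta q n + q ^ n * partialTheta q (n + 1) = 1 := by
  have h1 := (Equiv.addRight (1 : ℤ)).hasSum_iff.mpr (hasSum_partialTheta hq0 hq1 n)
  have h2 := (hasSum_partialTheta hq0 hq1 (n + 1)).mul_left (q ^ n)
  have h3 := h1.add h2
  have h4 : HasSum (fun u : ℤ => if u = -1 then (1 : ℂ) else 0) 1 := hasSum_ite_eq (-1) 1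
  refine h3.unique ?_
  convert! h4 using 1
  funext u
  simp only [Function.comp_apply, Equiv.coe_addRight]
  have key : thetaTerm q (q ^ n) (u + 1) = -(q ^ n * thetaTerm q (q ^ (n + 1)) u) := by
    rw [thetaTerm_add_one hq0 (zpow_ne_zero n hq0), thetaTerm, thetaTerm, zpow_add_one₀ hq0,
      mul_zpow]
    ring
  rcases lt_trichotomy u (-1) with h | rfl | h
  · rw [if_neg (by omega), if_neg (by omega), if_neg (by omega), mul_zero, add_zero]
  · simp [thetaTerm, binom2_zero]
  · rw [if_pos (by omega), if_pos (by omega), if_neg (by omega), key, neg_add_cancel]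

/-- For `n ≥ 0` the defining series is dominated by the theta series at `x = 1`; for `n < 0` the
complementary series over `u < 0` is. -/
theorem exists_bound_partialTheta {q : ℂ} (hq0 : q ≠ 0) (hq1 : ‖q‖ < 1) :
    ∃ M : ℝ, ∀ n : ℤ, ‖partialTheta q n‖ ≤ M := by
  have hs := summable_thetaTerm hq0 hq1 one_ne_zero
  refine ⟨∑' u, ‖thetaTerm q 1 u‖, fun n => ?_⟩
  have key : ∀ u : ℤ, 0 ≤ n * u → ‖thetaTerm q (q ^ n) u‖ ≤ ‖thetaTerm q 1 u‖ := by
    intro u hu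
    have h1 : ‖q‖ ^ (n * u) ≤ 1 := by
      obtain ⟨k, hk⟩ := Int.eq_ofNat_of_zero_le hu
      rw [hk, zpow_natCast]
      exact pow_le_one₀ (norm_nonneg q) hq1.le
    simp only [thetaTerm, norm_mul, norm_zpow, ← zpow_mul, one_zpow, norm_one]
    gcongr
  rcases le_or_gt 0 n with hn | hn
  · refine tsum_of_norm_bounded hs.hasSum fun u => ?_
    split_ifs with hu
    · exact key u (mul_nonneg hn hu)
    · simp
  · rw [← norm_neg, ← (hasSum_partialTheta_neg hq0 hq1 n).tsum_eq]
    refine tsum_of_norm_bounded hs.hasSum fun u => ?_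
    split_ifs with hu
    · exact key u (mul_nonneg_of_nonpos_of_nonpos hn.le hu.le)
    · simp

theorem Theta_symm {q x : ℂ} (hq0 : q ≠ 0) (hx : x ≠ 0) : Theta (q / x) q = Theta x q := by
  have : q / (q / x) = x := by field_simp
  rw [Theta, Theta, this, mul_comm (qPoch (q / x) q)]

/-- Laurent expansion of `Θ(x; q) / (1 - x q^r)` on the punctured plane. -/
theorem hasSum_Theta_div {q x : ℂ} (hq0 : q ≠ 0) (hq1 : ‖q‖ < 1) (hx0 : x ≠ 0)
    (hx : ∀ n : ℤ, x ≠ q ^ n) (r : ℤ) :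
    HasSum (fun k : ℤ => thetaTerm q (q / x) k * partialTheta q (k + r + 1))
      (Theta x q / (1 - x * q ^ r)) := by
  obtain ⟨M, hM⟩ := exists_bound_partialTheta hq0 hq1
  have hqx : q / x ≠ 0 := div_ne_zero hq0 hx0
  have hS : Summable fun k : ℤ => thetaTerm q (q / x) k * partialTheta q (k + r + 1) := by
    refine .of_norm_bounded ((summable_thetaTerm hq0 hq1 hqx).mul_right M) fun k => ?_
    rw [norm_mul]
    gcongr
    exact hM _
  have h1 := hS.hasSum
  have h2 := ((Equiv.addRight (1 : ℤ)).hasSum_iff.mpr h1).mul_left (x * q ^ r)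
  -- Multiplying by `1 - x q ^ r` leaves the theta series, by the recursion of `partialTheta`.
  have h3 := h1.sub h2
  have h4 := hasSum_thetaTerm hq0 hq1 hqx
  have h5 := h3.unique (by
    convert! h4 using 1
    funext k
    have hp := partialTheta_add hq0 hq1 (k + r + 1)
    simp only [Function.comp_apply, Equiv.coe_addRight]
    rw [thetaTerm_add_one hq0 hqx, show k + 1 + r + 1 = k + r + 1 + 1 by ring]
    have he : q ^ (k + r + 1) = q ^ k * q ^ r * q := by
      rw [zpow_add_one₀ hq0, zpow_add₀ hq0]
    rw [eq_sub_iff_add_eq.mpr hp, he]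
    field_simp
    ring)
  rw [Theta_symm hq0 hx0] at h5
  have hne : 1 - x * q ^ r ≠ 0 := by
    intro h
    refine hx (-r) ?_
    rw [zpow_neg]
    exact eq_inv_of_mul_eq_one_left (sub_eq_zero.mp h).symm
  convert! h1 using 1
  rw [div_eq_iff hne, ← h5]
  ring

/-- No condition on `x` is needed: at a pole the junk value of the inverse is zero. -/
theorem exists_bound_inv_one_sub {q x : ℂ} (hq0 : q ≠ 0) (hq1 : ‖q‖ < 1) (hx0 : x ≠ 0) :
    ∃ M : ℝ, ∀ r : ℤ, ‖(1 - x * q ^ r)⁻¹‖ ≤ M := by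
  have hpow : Tendsto (fun n : ℕ => q ^ n) atTop (𝓝 0) :=
    tendsto_pow_atTop_nhds_zero_of_norm_lt_one hq1
  have h1 : Tendsto (fun n : ℕ => (1 - x * q ^ n)⁻¹) atTop (𝓝 1) := by
    have : Tendsto (fun n : ℕ => 1 - x * q ^ n) atTop (𝓝 1) := by
      simpa using (hpow.const_mul x).const_sub 1
    simpa using this.inv₀ one_ne_zero
  have h2 : Tendsto (fun n : ℕ => (1 - x * q ^ (-(n : ℤ)))⁻¹) atTop (𝓝 0) := by
    have h3 : Tendsto (fun n : ℕ => q ^ n - x) atTop (𝓝 (-x)) := by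
      simpa using hpow.sub_const x
    have h4 := hpow.mul (h3.inv₀ (neg_ne_zero.mpr hx0))
    rw [zero_mul] at h4
    refine h4.congr fun n => ?_
    have hn := pow_ne_zero n hq0
    rw [zpow_neg, zpow_natCast, show 1 - x * (q ^ n)⁻¹ = (q ^ n - x) * (q ^ n)⁻¹ by field_simp,
      mul_inv, inv_inv, mul_comm]
  obtain ⟨C, hC⟩ := h1.norm.bddAbove_range
  obtain ⟨D, hD⟩ := h2.norm.bddAbove_range
  refine ⟨max C D, fun r => ?_⟩
  obtain ⟨n, rfl | rfl⟩ := r.eq_nat_or_neg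
  · exact (hC ⟨n, by simp⟩).trans (le_max_left _ _)
  · exact (hD ⟨n, rfl⟩).trans (le_max_right _ _)

theorem summable_div_one_sub {q x : ℂ} (hq0 : q ≠ 0) (hq1 : ‖q‖ < 1) (hx0 : x ≠ 0)
    {E : ℤ × ℤ → ℂ} (hE : Summable fun p => ‖E p‖) :
    Summable fun p : ℤ × ℤ => E p / (1 - x * q ^ p.1) := by
  obtain ⟨M, hM⟩ := exists_bound_inv_one_sub hq0 hq1 hx0
  refine .of_norm_bounded (hE.mul_right M) fun p => ?_
  rw [div_eq_mul_inv, norm_mul]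
  gcongr
  exact hM _

theorem summable_mul_partialTheta {ι : Type*} {q : ℂ} (hq0 : q ≠ 0) (hq1 : ‖q‖ < 1)
    {E : ι → ℂ} (hE : Summable fun p => ‖E p‖) (n : ι → ℤ) :
    Summable fun p => E p * partialTheta q (n p) := by
  obtain ⟨M, hM⟩ := exists_bound_partialTheta hq0 hq1
  refine .of_norm_bounded (hE.mul_right M) fun p => ?_
  rw [norm_mul]
  gcongr
  exact hM _

/-- Laurent expansion of `Θ(x; q)` times an Appell-type double series. -/
theorem Theta_mul_tsum_div {q x : ℂ} (hq0 : q ≠ 0) (hq1 : ‖q‖ < 1) (hx0 : x ≠ 0)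
    (hx : ∀ n : ℤ, x ≠ q ^ n) {E : ℤ × ℤ → ℂ} (hE : Summable fun p => ‖E p‖) :
    Theta x q * ∑' p : ℤ × ℤ, E p / (1 - x * q ^ p.1) =
      ∑' k : ℤ, thetaTerm q (q / x) k * ∑' p : ℤ × ℤ, E p * partialTheta q (k + p.1 + 1) := by
  have hth := summable_thetaTerm hq0 hq1 (div_ne_zero hq0 hx0)
  have hsum : Summable (Function.uncurry fun (k : ℤ) (p : ℤ × ℤ) =>
      thetaTerm q (q / x) k * (E p * partialTheta q (k + p.1 + 1))) := by
    convert! summable_mul_partialTheta hq0 hq1 (hth.mul_norm hE)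
      (fun z : ℤ × ℤ × ℤ => z.1 + z.2.1 + 1) using 1
    funext z
    simp only [Function.uncurry]
    ring
  calc Theta x q * ∑' p : ℤ × ℤ, E p / (1 - x * q ^ p.1)
      = ∑' p : ℤ × ℤ, ∑' k : ℤ,
          thetaTerm q (q / x) k * (E p * partialTheta q (k + p.1 + 1)) := by
        rw [← tsum_mul_left]
        refine tsum_congr fun p => ?_
        rw [← mul_div_assoc, mul_comm, mul_div_assoc,
          ← (hasSum_Theta_div hq0 hq1 hx0 hx p.1).tsum_eq, ← tsum_mul_left]
        exact tsum_congr fun k => by ring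
    _ = _ := by
        rw [hsum.tsum_comm]
        exact tsum_congr fun k => tsum_mul_left

/-! ### Hecke-type double and triple sums -/

theorem sg2_cases (r s : ℤ) : (0 ≤ r ∧ 0 ≤ s ∧ sg2 r s = 1) ∨ (r < 0 ∧ s < 0 ∧ sg2 r s = -1) ∨
    ((r < 0 ↔ 0 ≤ s) ∧ sg2 r s = 0) := by
  unfold sg2 sg
  rcases le_or_gt 0 r with hr | hr <;> rcases le_or_gt 0 s with hs | hs
  · left; simp [hr, hs]
  · right; right; simp [hr, hr.not_gt, hs.not_ge]
  · right; right; simp [hr, hs, hr.not_ge]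
  · right; left; simp [hr, hs, hr.not_ge, hs.not_ge]

theorem norm_zpow_le_one {q : ℂ} (hq1 : ‖q‖ < 1) {n : ℤ} (hn : 0 ≤ n) : ‖q ^ n‖ ≤ 1 := by
  obtain ⟨k, rfl⟩ := Int.eq_ofNat_of_zero_le hn
  rw [zpow_natCast, norm_pow]
  exact pow_le_one₀ (norm_nonneg q) hq1.le

theorem norm_zpow_lt_one {q : ℂ} (hq1 : ‖q‖ < 1) {n : ℤ} (hn : 0 < n) : ‖q ^ n‖ < 1 := by
  obtain ⟨k, rfl⟩ := Int.eq_ofNat_of_zero_le hn.le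
  rw [zpow_natCast, norm_pow]
  exact pow_lt_one₀ (norm_nonneg q) hq1 (by rintro rfl; simp at hn)

theorem norm_thetaTerm_zpow (q x : ℂ) (a n : ℤ) :
    ‖thetaTerm (q ^ a) x n‖ = ‖q ^ (a * binom2 n)‖ * ‖x ^ n‖ := by
  rw [thetaTerm, norm_mul, norm_mul, neg_one_zpow_norm, one_mul, zpow_mul]

theorem summable_norm_heckeTerm {q x y : ℂ} (hq0 : q ≠ 0) (hq1 : ‖q‖ < 1) (hx : x ≠ 0) (hy : y ≠ 0)
    {a b c : ℤ} (ha : 0 < a) (hb : 0 ≤ b) (hc : 0 < c) :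
    Summable fun p => ‖heckeTerm a b c x y q p‖ := by
  have h1 := summable_thetaTerm (zpow_ne_zero a hq0) (norm_zpow_lt_one hq1 ha) hx
  have h2 := summable_thetaTerm (zpow_ne_zero c hq0) (norm_zpow_lt_one hq1 hc) hy
  refine .of_nonneg_of_le (fun _ => norm_nonneg _) (fun p => ?_) (h1.mul_norm h2)
  have hnn := norm_nonneg (thetaTerm (q ^ a) x p.1 * thetaTerm (q ^ c) y p.2)
  have key : 0 ≤ p.1 * p.2 → ‖sg2 p.1 p.2‖ ≤ 1 → ‖heckeTerm a b c x y q p‖ ≤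
      ‖thetaTerm (q ^ a) x p.1 * thetaTerm (q ^ c) y p.2‖ := by
    intro hp hs
    have hq := norm_zpow_le_one hq1 (mul_nonneg hb hp)
    rw [heckeTerm, norm_mul, norm_mul, norm_mul, norm_mul, norm_mul, neg_one_zpow_norm,
      norm_thetaTerm_zpow, norm_thetaTerm_zpow, zpow_add₀ hq0, zpow_add₀ hq0, norm_mul, norm_mul,
      mul_assoc b]
    calc _ ≤ 1 * 1 * ‖x ^ p.1‖ * ‖y ^ p.2‖ *
          (‖q ^ (a * binom2 p.1)‖ * 1 * ‖q ^ (c * binom2 p.2)‖) := by gcongr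
      _ = _ := by ring
  rcases sg2_cases p.1 p.2 with ⟨hr, hs, h⟩ | ⟨hr, hs, h⟩ | ⟨-, h⟩
  · exact key (mul_nonneg hr hs) (by simp [h])
  · exact key (mul_nonneg_of_nonpos_of_nonpos hr.le hs.le) (by simp [h])
  · simpa [heckeTerm, h] using hnn

theorem norm_tripleTerm_le {q : ℂ} (hq0 : q ≠ 0) (hq1 : ‖q‖ < 1) (x y z : ℂ)
    (a c f : ℤ) {b d e : ℤ} (hb : 0 ≤ b) (hd : 0 ≤ d) (he : 0 ≤ e) {p : ℤ × ℤ × ℤ}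
    (hp : p ∈ nonnegTriples ∪ negTriples) :
    ‖tripleTerm a b c d e f x y z q p‖ ≤
      ‖thetaTerm (q ^ a) x p.1 * (thetaTerm (q ^ c) y p.2.1 * thetaTerm (q ^ f) z p.2.2)‖ := by
  obtain ⟨h1, h2, h3⟩ : 0 ≤ p.1 * p.2.1 ∧ 0 ≤ p.1 * p.2.2 ∧ 0 ≤ p.2.1 * p.2.2 := by
    rcases hp with ⟨h1, h2, h3⟩ | ⟨h1, h2, h3⟩
    · exact ⟨mul_nonneg h1 h2, mul_nonneg h1 h3, mul_nonneg h2 h3⟩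
    · exact ⟨mul_nonneg_of_nonpos_of_nonpos h1.le h2.le,
        mul_nonneg_of_nonpos_of_nonpos h1.le h3.le, mul_nonneg_of_nonpos_of_nonpos h2.le h3.le⟩
  have g1 := norm_zpow_le_one hq1 (mul_nonneg hb h1)
  have g2 := norm_zpow_le_one hq1 (mul_nonneg hd h2)
  have g3 := norm_zpow_le_one hq1 (mul_nonneg he h3)
  simp only [tripleTerm, norm_mul, neg_one_zpow_norm, norm_thetaTerm_zpow, zpow_add₀ hq0,
    mul_assoc b, mul_assoc d, mul_assoc e]
  calc _ ≤ 1 * ‖x ^ p.1‖ * ‖y ^ p.2.1‖ * ‖z ^ p.2.2‖ *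
        (‖q ^ (a * binom2 p.1)‖ * 1 * ‖q ^ (c * binom2 p.2.1)‖ * 1 * 1 *
          ‖q ^ (f * binom2 p.2.2)‖) := by gcongr
    _ = _ := by ring

/-- The summands of both parts of `𝔤_{a,b,c,d,e,f}` form one summable family over `ℤ³`. -/
theorem summable_indicator_tripleTerm {q x y z : ℂ} (hq0 : q ≠ 0) (hq1 : ‖q‖ < 1) (hx : x ≠ 0)
    (hy : y ≠ 0) (hz : z ≠ 0) {a b c d e f : ℤ} (ha : 0 < a) (hb : 0 ≤ b) (hc : 0 < c)
    (hd : 0 ≤ d) (he : 0 ≤ e) (hf : 0 < f) :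
    Summable ((nonnegTriples ∪ negTriples).indicator (tripleTerm a b c d e f x y z q)) := by
  have h1 := summable_thetaTerm (zpow_ne_zero a hq0) (norm_zpow_lt_one hq1 ha) hx
  have h2 := summable_thetaTerm (zpow_ne_zero c hq0) (norm_zpow_lt_one hq1 hc) hy
  have h3 := summable_thetaTerm (zpow_ne_zero f hq0) (norm_zpow_lt_one hq1 hf) hz
  refine .of_norm_bounded (h1.mul_norm (h2.mul_norm h3)) fun p => ?_
  by_cases hp : p ∈ nonnegTriples ∪ negTriples
  · rw [Set.indicator_of_mem hp]
    exact norm_tripleTerm_le hq0 hq1 x y z a c f hb hd he hp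
  · rw [Set.indicator_of_notMem hp, norm_zero]
    exact norm_nonneg _

theorem disjoint_triples : Disjoint nonnegTriples negTriples :=
  Set.disjoint_left.mpr fun _ h1 h2 => h1.1.not_gt h2.1

theorem tripleSummable {q x y z : ℂ} (hq0 : q ≠ 0) (hq1 : ‖q‖ < 1) (hx : x ≠ 0)
    (hy : y ≠ 0) (hz : z ≠ 0) {a b c d e f : ℤ} (ha : 0 < a) (hb : 0 ≤ b) (hc : 0 < c)
    (hd : 0 ≤ d) (he : 0 ≤ e) (hf : 0 < f) : TripleSummable a b c d e f x y z q := by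
  have h := summable_indicator_tripleTerm hq0 hq1 hx hy hz ha hb hc hd he hf
  have h1 := h.indicator nonnegTriples
  have h2 := h.indicator negTriples
  rw [Set.indicator_indicator, Set.inter_eq_left.mpr Set.subset_union_left] at h1
  rw [Set.indicator_indicator, Set.inter_eq_left.mpr Set.subset_union_right] at h2
  have h3 := summable_subtype_iff_indicator.mpr h1
  have h4 := summable_subtype_iff_indicator.mpr h2
  exact ⟨h3, h4⟩

theorem triple_eq_tsum_indicator {q x y z : ℂ} {a b c d e f : ℤ}
    (h : TripleSummable a b c d e f x y z q) :
    triple a b c d e f x y z q =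
      ∑' p, (nonnegTriples ∪ negTriples).indicator (tripleTerm a b c d e f x y z q) p := by
  set g := tripleTerm a b c d e f x y z q with hg
  obtain ⟨h1, h2⟩ : (Summable fun p : nonnegTriples => g p) ∧
    Summable fun p : negTriples => g p := h
  replace h1 := (summable_subtype_iff_indicator (f := g)).mp h1
  replace h2 := (summable_subtype_iff_indicator (f := g)).mp h2
  rw [triple, ← hg, tsum_subtype _ g, tsum_subtype _ g, ← h1.tsum_add h2]
  exact tsum_congr fun p => (congrFun (Set.indicator_union_of_disjoint disjoint_triples _) p).symm

/-- Summing `𝔤_{1,1,c,1,c,1}(x, y, q^j; q)` over its last index. -/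
theorem triple_eq_tsum {q x y : ℂ} (hq0 : q ≠ 0) (hq1 : ‖q‖ < 1) (hx : x ≠ 0) (hy : y ≠ 0)
    {c : ℤ} (hc : 0 < c) (j : ℤ) :
    triple 1 1 c 1 c 1 x y (q ^ j) q =
      ∑' p : ℤ × ℤ, heckeTerm 1 1 c x y q p * partialTheta q (j + p.1 + c * p.2) := by
  have hz : q ^ j ≠ 0 := zpow_ne_zero j hq0
  have hsum := summable_indicator_tripleTerm hq0 hq1 hx hy hz one_pos zero_le_one hc zero_le_one
    hc.le one_pos
  rw [triple_eq_tsum_indicator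
      (tripleSummable hq0 hq1 hx hy hz one_pos zero_le_one hc zero_le_one hc.le one_pos),
    ← (Equiv.prodAssoc ℤ ℤ ℤ).tsum_eq,
    Summable.tsum_prod (by exact (Equiv.prodAssoc ℤ ℤ ℤ).summable_iff.mpr hsum)]
  refine tsum_congr fun p => ?_
  obtain ⟨k, s⟩ := p
  have hterm : ∀ u : ℤ, tripleTerm 1 1 c 1 c 1 x y (q ^ j) q (k, s, u) =
      (-1) ^ (k + s) * x ^ k * y ^ s * q ^ (1 * binom2 k + 1 * k * s + c * binom2 s) *
        thetaTerm q (q ^ (j + k + c * s)) u := by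
    intro u
    simp only [tripleTerm, thetaTerm, ← zpow_mul, zpow_add₀ hq0, mul_zpow,
      zpow_add₀ (neg_ne_zero.mpr one_ne_zero : (-1 : ℂ) ≠ 0), one_mul]
    ring
  have hmem : ∀ u : ℤ, (k, s, u) ∈ nonnegTriples ∪ negTriples ↔
      (0 ≤ k ∧ 0 ≤ s ∧ 0 ≤ u) ∨ (k < 0 ∧ s < 0 ∧ u < 0) := fun u => Iff.rfl
  simp only [heckeTerm, Equiv.prodAssoc_apply, Set.indicator, hmem, hterm]
  rcases sg2_cases k s with ⟨hk, hs, h⟩ | ⟨hk, hs, h⟩ | ⟨hks, h⟩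
  · rw [h, one_mul, ← (hasSum_partialTheta hq0 hq1 (j + k + c * s)).tsum_eq, ← tsum_mul_left]
    refine tsum_congr fun u => ?_
    simp [hk, hs, hk.not_gt]
  · rw [h, neg_one_mul, neg_mul, neg_mul, neg_mul, neg_mul, ← mul_neg,
      ← (hasSum_partialTheta_neg hq0 hq1 (j + k + c * s)).tsum_eq, ← tsum_mul_left]
    refine tsum_congr fun u => ?_
    simp [hk, hs, hk.not_ge]
  · simp only [h, zero_mul]
    convert! tsum_zero with u
    rw [if_neg]
    omega

/-! ### The coefficients of the Appell-type series -/

theorem heckeTerm_eq_thetaTerm {q x y : ℂ} (hq0 : q ≠ 0) (c k s : ℤ) :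
    heckeTerm 1 1 c x y q (k, s) =
      thetaTerm q x k * (sg2 k s * thetaTerm (q ^ c) (y * q ^ k) s) := by
  simp only [heckeTerm, thetaTerm, zpow_add₀ hq0, mul_zpow, ← zpow_mul, one_mul,
    zpow_add₀ (neg_ne_zero.mpr one_ne_zero : (-1 : ℂ) ≠ 0)]
  ring

/-- The coefficient `(-1)^r q^Q` of `1 / (1 - x q^r)` in the Appell-type series, `Q` being the
quadratic polynomial in `(r, s)` that appears in `ellTerm`, with `T` in place of `3 t`. -/
noncomputable def appellCoeff (T m : ℤ) (q : ℂ) (r s : ℤ) : ℂ :=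
  (-1) ^ r * q ^ (binom2 r + T * r * s + T * (T - 1) * binom2 s
    + (m + 1) * r + (binom2 T + T - 1) * s)

/-- The case `k = 1` gives the coefficients of the Appell-type series, and `k = 0` the Hecke-type sum
of the identity. -/
theorem heckeTerm_zpow_neg_zpow {q : ℂ} (hq0 : q ≠ 0) (T m : ℤ) (k : ℤ) (p : ℤ × ℤ) :
    heckeTerm 1 T (T * (T - 1)) (q ^ (m + k)) (-q ^ (binom2 T + T - 1)) q p =
      sg2 p.1 p.2 * (appellCoeff T m q p.1 p.2 * q ^ ((k - 1) * p.1)) := by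
  have h1 : (-q ^ (binom2 T + T - 1)) ^ p.2 = (-1) ^ p.2 * q ^ ((binom2 T + T - 1) * p.2) := by
    rw [← neg_one_mul, mul_zpow, ← zpow_mul]
  have h2 : (-1 : ℂ) ^ p.2 * (-1) ^ p.2 = 1 := by
    rw [← mul_zpow]; simp
  have h3 : q ^ (binom2 p.1 + T * p.1 * p.2 + T * (T - 1) * binom2 p.2
      + (m + 1) * p.1 + (binom2 T + T - 1) * p.2) * q ^ ((k - 1) * p.1) =
      q ^ ((m + k) * p.1) * q ^ ((binom2 T + T - 1) * p.2) *
      q ^ (1 * binom2 p.1 + T * p.1 * p.2 + T * (T - 1) * binom2 p.2) := by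
    rw [← zpow_add₀ hq0, ← zpow_add₀ hq0, ← zpow_add₀ hq0]
    congr 1
    ring
  rw [heckeTerm, h1, appellCoeff, mul_assoc _ (q ^ _) (q ^ _), h3,
    zpow_add₀ (neg_ne_zero.mpr one_ne_zero : (-1 : ℂ) ≠ 0), ← zpow_mul]
  linear_combination (sg2 p.1 p.2 * (-1) ^ p.1 * (q ^ ((m + k) * p.1) *
    q ^ ((binom2 T + T - 1) * p.2) *
    q ^ (1 * binom2 p.1 + T * p.1 * p.2 + T * (T - 1) * binom2 p.2))) * h2

theorem summable_norm_sg2_mul_appellCoeff {q : ℂ} (hq0 : q ≠ 0) (hq1 : ‖q‖ < 1) {T : ℤ}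
    (hT : 2 ≤ T) (m : ℤ) :
    Summable fun p : ℤ × ℤ => ‖sg2 p.1 p.2 * appellCoeff T m q p.1 p.2‖ := by
  have h := summable_norm_heckeTerm hq0 hq1 (zpow_ne_zero (m + 1) hq0)
    (neg_ne_zero.mpr (zpow_ne_zero (binom2 T + T - 1) hq0)) one_pos (by omega : 0 ≤ T)
    (mul_pos (by omega) (by omega) : 0 < T * (T - 1))
  simpa [heckeTerm_zpow_neg_zpow hq0] using h

theorem appellCoeff_shift {q : ℂ} (hq0 : q ≠ 0) (T m r s : ℤ) :
    appellCoeff T m q (r - (T - 1)) (s + 1) =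
      (-1) ^ (T + 1) * q ^ (r - (T - 1) * m) * appellCoeff T m q r s := by
  have hs : (-1 : ℂ) ^ (r - (T - 1)) = (-1) ^ (T + 1) * (-1) ^ r := by
    rw [← zpow_add₀ (by norm_num), show T + 1 + r = r - (T - 1) + 2 * T by ring,
      zpow_add₀ (by norm_num), zpow_mul]
    simp
  have he : ∀ A B C : ℤ, A = B + C → q ^ A = q ^ B * q ^ C := fun A B C h => by
    rw [h, zpow_add₀ hq0]
  rw [appellCoeff, appellCoeff, hs, he _ (r - (T - 1) * m)
    (binom2 r + T * r * s + T * (T - 1) * binom2 s + (m + 1) * r + (binom2 T + T - 1) * s) ?_]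
  · ring
  · have h1 := two_mul_binom2 (r - (T - 1))
    have h2 := two_mul_binom2 r
    have h3 := two_mul_binom2 T
    rw [binom2_add_one]
    linarith

/-- The bilateral sum of the coefficients along a row. -/
theorem hasSum_appellCoeff {q : ℂ} (hq0 : q ≠ 0) (hq1 : ‖q‖ < 1) {T : ℤ} (hT : 2 ≤ T) (m i : ℤ) :
    HasSum (appellCoeff T m q i) ((-1) ^ i * q ^ (binom2 (i + 1) + m * i) *
      Theta (-q ^ (binom2 T + T - 1 + T * i)) (q ^ (T * (T - 1)))) := by
  have hTT : 0 < T * (T - 1) := mul_pos (by omega) (by omega)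
  have h := (hasSum_thetaTerm (zpow_ne_zero _ hq0) (norm_zpow_lt_one hq1 hTT)
    (neg_ne_zero.mpr (zpow_ne_zero (binom2 T + T - 1 + T * i) hq0))).mul_left
    ((-1) ^ i * q ^ (binom2 (i + 1) + m * i))
  convert! h using 1
  funext s
  have h1 : (-q ^ (binom2 T + T - 1 + T * i)) ^ s =
      (-1) ^ s * q ^ ((binom2 T + T - 1 + T * i) * s) := by
    rw [← neg_one_mul, mul_zpow, ← zpow_mul]
  have h2 : (-1 : ℂ) ^ s * (-1) ^ s = 1 := by
    rw [← mul_zpow]; simp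
  have h3 : q ^ (binom2 i + T * i * s + T * (T - 1) * binom2 s
      + (m + 1) * i + (binom2 T + T - 1) * s) = q ^ (binom2 (i + 1) + m * i) *
      q ^ (T * (T - 1) * binom2 s) * q ^ ((binom2 T + T - 1 + T * i) * s) := by
    rw [← zpow_add₀ hq0, ← zpow_add₀ hq0, binom2_add_one]
    congr 1
    ring
  rw [thetaTerm, h1, ← zpow_mul, appellCoeff, h3]
  linear_combination (-((-1) ^ i * q ^ (binom2 (i + 1) + m * i) *
    q ^ (T * (T - 1) * binom2 s) * q ^ ((binom2 T + T - 1 + T * i) * s))) * h2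

theorem zpow_ne_zpow {q : ℂ} (hq0 : q ≠ 0) (hq1 : ‖q‖ < 1) {a b : ℤ} (hab : a ≠ b) :
    q ^ a ≠ q ^ b := fun h => hab <| zpow_right_injective₀ (norm_pos_iff.mpr hq0) hq1.ne <| by
  simpa using congrArg norm h

/-- Two evaluations of the sum at `(a, b)`, by the recursion of `partialTheta` and by shifting `r`,
give `-q^b` and `-q^a` times the sum at `(a + 1, b + 1)`. The condition `a ≠ b` cannot be dropped. -/
theorem hasSum_thetaTerm_mul_partialTheta {q : ℂ} (hq0 : q ≠ 0) (hq1 : ‖q‖ < 1) {a b : ℤ}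
    (hab : a ≠ b) : HasSum (fun r : ℤ => thetaTerm q (q ^ a) r * partialTheta q (r + b)) 0 := by
  have hs : ∀ a b : ℤ, Summable fun r : ℤ => thetaTerm q (q ^ a) r * partialTheta q (r + b) :=
    fun a b => summable_mul_partialTheta hq0 hq1
      (summable_thetaTerm hq0 hq1 (zpow_ne_zero a hq0)) fun r => r + b
  set S := ∑' r : ℤ, thetaTerm q (q ^ (a + 1)) r * partialTheta q (r + (b + 1)) with hS
  have h1 : HasSum (fun r : ℤ => thetaTerm q (q ^ a) r * partialTheta q (r + b))
      (0 - q ^ b * S) := by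
    convert! (hasSum_thetaTerm_zpow hq0 hq1 a).sub ((hs (a + 1) (b + 1)).hasSum.mul_left (q ^ b))
      using 1
    funext r
    rw [eq_sub_iff_add_eq.mpr (partialTheta_add hq0 hq1 (r + b)), ← add_assoc, thetaTerm, thetaTerm,
      zpow_add_one₀ hq0 a, zpow_add₀ hq0 r, mul_zpow]
    ring
  have h2 : HasSum (fun r : ℤ => thetaTerm q (q ^ a) r * partialTheta q (r + b)) (-q ^ a * S) := by
    rw [← (Equiv.addRight (1 : ℤ)).hasSum_iff]
    convert! (hs (a + 1) (b + 1)).hasSum.mul_left (-q ^ a) using 1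
    funext r
    simp only [Function.comp_apply, Equiv.coe_addRight]
    rw [thetaTerm_add_one hq0 (zpow_ne_zero a hq0), thetaTerm, thetaTerm, zpow_add_one₀ hq0,
      mul_zpow, add_right_comm, add_assoc r]
    ring
  have h3 := h1.unique h2
  have h4 : (q ^ a - q ^ b) * S = 0 := by linear_combination h3
  have h5 := (mul_eq_zero.mp h4).resolve_left (sub_ne_zero.mpr (zpow_ne_zpow hq0 hq1 hab))
  rw [h5, mul_zero] at h2
  exact h2

/-- The row `s = -1` is a theta series, whose sum against `partialTheta` vanishes except for one
value of `k`. -/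
theorem hasSum_appellCoeff_neg_one {q : ℂ} (hq0 : q ≠ 0) (hq1 : ‖q‖ < 1) {T m k : ℤ}
    (hk : k ≠ m - T) :
    HasSum (fun r : ℤ => appellCoeff T m q r (-1) * partialTheta q (k + r + 1)) 0 := by
  have h := (hasSum_thetaTerm_mul_partialTheta hq0 hq1
    (by omega : m + 1 - T ≠ k + 1)).mul_left (q ^ (T * (T - 1) - (binom2 T + T - 1)))
  rw [mul_zero] at h
  convert! h using 1
  funext r
  have h1 : q ^ (binom2 r + T * r * (-1) + T * (T - 1) * binom2 (-1)
      + (m + 1) * r + (binom2 T + T - 1) * (-1)) = q ^ (T * (T - 1) - (binom2 T + T - 1)) *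
      q ^ binom2 r * q ^ ((m + 1 - T) * r) := by
    rw [← zpow_add₀ hq0, ← zpow_add₀ hq0, binom2_neg, binom2_one]
    congr 1
    ring
  rw [appellCoeff, h1, thetaTerm, ← zpow_mul, show k + r + 1 = r + (k + 1) by ring]
  ring

/-! ### The recursion for the Laurent coefficients -/

/-- The normalized coefficient of `x^{-k}` in `Θ(x; q)` times the Appell-type series. -/
noncomputable def laurentCoeff (T m : ℤ) (q : ℂ) (k : ℤ) : ℂ :=
  ∑' p : ℤ × ℤ, sg2 p.1 p.2 * appellCoeff T m q p.1 p.2 * partialTheta q (k + p.1 + 1)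

/-- The inhomogeneous term of the recursion for `laurentCoeff`. -/
noncomputable def recursionTerm (T m : ℤ) (q : ℂ) (k : ℤ) : ℂ :=
  (-1) ^ (T + 1) * q ^ ((1 - m) * (1 - T)) *
      hecke 1 T (T * (T - 1)) (q ^ m) (-q ^ (binom2 T + T - 1)) q +
    ∑ i ∈ Finset.Icc (0 : ℤ) (T - 2), (-1) ^ i * q ^ (binom2 (i + 1) + m * i) *
      Theta (-q ^ (binom2 T + T - 1 + T * i)) (q ^ (T * (T - 1))) * partialTheta q (i + 1 + k)

theorem hasSum_laurentCoeff {q : ℂ} (hq0 : q ≠ 0) (hq1 : ‖q‖ < 1) {T : ℤ} (hT : 2 ≤ T) (m k : ℤ) :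
    HasSum (fun p : ℤ × ℤ => sg2 p.1 p.2 * appellCoeff T m q p.1 p.2 *
      partialTheta q (k + p.1 + 1)) (laurentCoeff T m q k) :=
  (summable_mul_partialTheta hq0 hq1 (summable_norm_sg2_mul_appellCoeff hq0 hq1 hT m)
    fun p => k + p.1 + 1).hasSum

theorem sg2_sub_sg2_shift {T : ℤ} (hT : 2 ≤ T) (r s : ℤ) :
    sg2 r s - sg2 (r - (T - 1)) (s + 1) =
      (if r ∈ Finset.Icc (0 : ℤ) (T - 2) then 1 else 0) - if s = -1 then 1 else 0 := by
  have h1 : sg r - sg (r - (T - 1)) = if r ∈ Finset.Icc (0 : ℤ) (T - 2) then 2 else 0 := by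
    simp only [sg, Finset.mem_Icc]
    split_ifs <;> first | omega | norm_num
  have h2 : sg s - sg (s + 1) = -if s = -1 then 2 else 0 := by
    simp only [sg]
    split_ifs <;> first | omega | norm_num
  have h3 : sg2 r s - sg2 (r - (T - 1)) (s + 1) =
      ((sg r - sg (r - (T - 1))) + (sg s - sg (s + 1))) / 2 := by
    simp only [sg2]; ring
  rw [h3, h1, h2]
  split_ifs <;> norm_num

theorem hasSum_ite_fst {f : ℤ → ℂ} {a : ℂ} (hf : HasSum f a) (i : ℤ) :
    HasSum (fun p : ℤ × ℤ => if p.1 = i then f p.2 else 0) a := by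
  have hinj : Function.Injective fun s : ℤ => (i, s) := fun _ _ h => (Prod.ext_iff.mp h).2
  refine (hinj.hasSum_iff fun p hp => if_neg fun h => hp ⟨p.2, Prod.ext h.symm rfl⟩).mp ?_
  simpa [Function.comp_def] using hf

theorem hasSum_ite_snd {f : ℤ → ℂ} {a : ℂ} (hf : HasSum f a) (j : ℤ) :
    HasSum (fun p : ℤ × ℤ => if p.2 = j then f p.1 else 0) a := by
  have hinj : Function.Injective fun r : ℤ => (r, j) := fun _ _ h => (Prod.ext_iff.mp h).1
  refine (hinj.hasSum_iff fun p hp => if_neg fun h => hp ⟨p.1, Prod.ext rfl h.symm⟩).mp ?_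
  simpa [Function.comp_def] using hf

theorem hasSum_hecke_shift {q : ℂ} (hq0 : q ≠ 0) (hq1 : ‖q‖ < 1) {T : ℤ} (hT : 2 ≤ T) (m : ℤ) :
    HasSum (fun p : ℤ × ℤ => sg2 (p.1 - (T - 1)) (p.2 + 1) * appellCoeff T m q p.1 p.2)
      ((-1) ^ (T + 1) * q ^ ((1 - m) * (1 - T)) *
        hecke 1 T (T * (T - 1)) (q ^ m) (-q ^ (binom2 T + T - 1)) q) := by
  have hF := (summable_norm_heckeTerm hq0 hq1 (zpow_ne_zero m hq0)
    (neg_ne_zero.mpr (zpow_ne_zero (binom2 T + T - 1) hq0)) one_pos (by omega : 0 ≤ T)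
    (mul_pos (by omega) (by omega) : 0 < T * (T - 1))).of_norm.hasSum
  have h := (((Equiv.subRight (T - 1)).prodCongr (Equiv.addRight (1 : ℤ))).hasSum_iff.mpr
    hF).mul_left ((-1) ^ (T + 1) * q ^ ((1 - m) * (1 - T)))
  convert! h using 1
  funext p
  have h0 := heckeTerm_zpow_neg_zpow hq0 T m 0 (p.1 - (T - 1), p.2 + 1)
  have hsq : (-1 : ℂ) ^ (T + 1) * (-1) ^ (T + 1) = 1 := by
    rw [← mul_zpow]; simp
  have hq : q ^ ((1 - m) * (1 - T)) * q ^ (p.1 - (T - 1) * m) *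
      q ^ ((0 - 1) * (p.1 - (T - 1))) = 1 := by
    rw [← zpow_add₀ hq0, ← zpow_add₀ hq0, ← zpow_zero q]
    congr 1
    ring
  simp only [add_zero] at h0
  simp only [Function.comp_apply, Equiv.prodCongr_apply, Prod.map, Equiv.subRight_apply,
    Equiv.coe_addRight]
  rw [h0, appellCoeff_shift hq0]
  linear_combination (-(sg2 (p.1 - (T - 1)) (p.2 + 1) * appellCoeff T m q p.1 p.2)) * hsq -
    (sg2 (p.1 - (T - 1)) (p.2 + 1) * appellCoeff T m q p.1 p.2 *
      ((-1) ^ (T + 1) * (-1) ^ (T + 1))) * hq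

/-- Reindexing `laurentCoeff T m q (k + T)` by `(r, s) ↦ (r - (T - 1), s + 1)` turns its terms into
those of `laurentCoeff T m q k`, up to the change of `sg2` and the `1` in
`P(n) + q^n P(n + 1) = 1`. -/
theorem laurentCoeff_recursion {q : ℂ} (hq0 : q ≠ 0) (hq1 : ‖q‖ < 1) {T : ℤ} (hT : 2 ≤ T)
    {m k : ℤ} (hk : k ≠ m - T) :
    laurentCoeff T m q k - (-1) ^ T * q ^ ((T - 1) * m + 1 + k) * laurentCoeff T m q (k + T) =
      recursionTerm T m q k := by
  have h1 := hasSum_laurentCoeff hq0 hq1 hT m k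
  have h2 := (((Equiv.subRight (T - 1)).prodCongr (Equiv.addRight (1 : ℤ))).hasSum_iff.mpr
    (hasSum_laurentCoeff hq0 hq1 hT m (k + T))).mul_left
    ((-1) ^ T * q ^ ((T - 1) * m + 1 + k))
  have h3 := hasSum_hecke_shift hq0 hq1 hT m
  have h4 := hasSum_sum (s := Finset.Icc (0 : ℤ) (T - 2)) fun i _ =>
    hasSum_ite_fst ((hasSum_appellCoeff hq0 hq1 hT m i).mul_right (partialTheta q (i + 1 + k))) i
  have h5 := hasSum_ite_snd (hasSum_appellCoeff_neg_one hq0 hq1 hk) (-1)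
  have h6 := (h3.add h4).sub h5
  rw [sub_zero] at h6
  refine (h1.sub h2).unique ?_
  convert! h6 using 1
  funext p
  obtain ⟨r, s⟩ := p
  have hP := partialTheta_add hq0 hq1 (k + r + 1)
  have hsg := sg2_sub_sg2_shift hT r s
  have hsq : (-1 : ℂ) ^ T * (-1) ^ (T + 1) = -1 := by
    rw [zpow_add_one₀ (by norm_num), ← mul_assoc, ← mul_zpow]; simp
  have hq : q ^ ((T - 1) * m + 1 + k) * q ^ (r - (T - 1) * m) = q ^ (k + r + 1) := by
    rw [← zpow_add₀ hq0]
    congr 1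
    ring
  have hsum : (∑ i ∈ Finset.Icc (0 : ℤ) (T - 2),
      if r = i then appellCoeff T m q i s * partialTheta q (i + 1 + k) else 0) =
      (if r ∈ Finset.Icc (0 : ℤ) (T - 2) then 1 else 0) *
        (appellCoeff T m q r s * partialTheta q (k + r + 1)) := by
    rw [Finset.sum_ite_eq, ite_mul, one_mul, zero_mul, show r + 1 + k = k + r + 1 by ring]
  have hneg : (if s = -1 then appellCoeff T m q r (-1) * partialTheta q (k + r + 1) else 0) =
      (if s = -1 then 1 else 0) * (appellCoeff T m q r s * partialTheta q (k + r + 1)) := by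
    split_ifs with h <;> simp [h]
  simp only [Function.comp_apply, Equiv.prodCongr_apply, Prod.map, Equiv.subRight_apply,
    Equiv.coe_addRight]
  rw [hsum, hneg, appellCoeff_shift hq0,
    show k + T + (r - (T - 1)) + 1 = k + r + 1 + 1 by ring]
  set sh := sg2 (r - (T - 1)) (s + 1)
  set e := appellCoeff T m q r s
  set P' := partialTheta q (k + r + 1 + 1)
  linear_combination (e * partialTheta q (k + r + 1)) * hsg + (sh * e) * hP -
    (q ^ ((T - 1) * m + 1 + k) * q ^ (r - (T - 1) * m) * sh * e * P') * hsq +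
    (sh * e * P') * hq

theorem exists_bound_laurentCoeff {q : ℂ} (hq0 : q ≠ 0) (hq1 : ‖q‖ < 1) {T : ℤ} (hT : 2 ≤ T)
    (m : ℤ) : ∃ M : ℝ, ∀ k : ℤ, ‖laurentCoeff T m q k‖ ≤ M := by
  obtain ⟨M, hM⟩ := exists_bound_partialTheta hq0 hq1
  have hs := (summable_norm_sg2_mul_appellCoeff hq0 hq1 hT m).mul_right M
  refine ⟨_, fun k => tsum_of_norm_bounded hs.hasSum fun p => ?_⟩
  rw [norm_mul]
  gcongr
  exact hM _

/-- Iterating the recursion, upwards for `k ≥ 0` and downwards for `k < 0`; the bounds on `m` keep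
the exceptional index `m - T` off the iteration. -/
theorem laurentCoeff_eq_tsum {q : ℂ} (hq0 : q ≠ 0) (hq1 : ‖q‖ < 1) {T : ℤ} (hT : 2 ≤ T)
    {m : ℤ} (hm0 : 0 ≤ m) (hm1 : m ≤ T - 1) (k : ℤ) :
    laurentCoeff T m q k = ∑' s : ℤ, sg2 k s *
      thetaTerm (q ^ T) ((-1) ^ (T + 1) * q ^ ((T - 1) * m + 1) * q ^ k) s *
        recursionTerm T m q (k + T * s) := by
  set X := (-1) ^ (T + 1) * q ^ ((T - 1) * m + 1) * q ^ k with hX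
  have hX0 : X ≠ 0 := mul_ne_zero (mul_ne_zero (zpow_ne_zero _ (by norm_num))
    (zpow_ne_zero _ hq0)) (zpow_ne_zero _ hq0)
  have hqT := zpow_ne_zero T hq0
  obtain ⟨M, hM⟩ := exists_bound_laurentCoeff hq0 hq1 hT m
  set v : ℤ → ℂ := fun s => thetaTerm (q ^ T) X s * laurentCoeff T m q (k + T * s) with hv
  have hsv : Summable fun s => ‖v s‖ := by
    refine .of_nonneg_of_le (fun _ => norm_nonneg _) (fun s => ?_)
      ((summable_thetaTerm hqT (norm_zpow_lt_one hq1 (by omega : 0 < T)) hX0).mul_right M)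
    rw [hv, norm_mul]
    gcongr
    exact hM _
  have hsg : ∀ s, ‖sg2 k s‖ ≤ 1 := fun s => by
    rcases sg2_cases k s with ⟨-, -, h⟩ | ⟨-, -, h⟩ | ⟨-, h⟩ <;> simp [h]
  have h1 : Summable fun s => sg2 k s * v s := by
    refine .of_norm_bounded hsv fun s => ?_
    rw [norm_mul]
    exact mul_le_of_le_one_left (norm_nonneg _) (hsg s)
  have h2 : Summable fun s => sg2 k s * v (s + 1) := by
    refine .of_norm_bounded ((Equiv.addRight (1 : ℤ)).summable_iff.mpr hsv) fun s => ?_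
    rw [norm_mul]
    exact mul_le_of_le_one_left (norm_nonneg _) (hsg s)
  -- Summation by parts: `sg(k, s)` jumps only at `s = 0`.
  have h3 := h1.hasSum.sub ((Equiv.subRight (1 : ℤ)).hasSum_iff.mpr h2.hasSum)
  have h4 : HasSum (fun s : ℤ => if s = 0 then v 0 else 0) (v 0) := hasSum_ite_eq 0 (v 0)
  have h5 := h3.unique (by
    convert! h4 using 1
    funext s
    simp only [Function.comp_apply, Equiv.subRight_apply, sub_add_cancel]
    have h6 : sg2 k s - sg2 k (s - 1) = if s = 0 then 1 else 0 := by
      simp only [sg2, sg]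
      split_ifs <;> first | omega | norm_num
    rw [← sub_mul, h6, ite_mul, one_mul, zero_mul]
    split_ifs with h
    · rw [h]
    · rfl)
  have hv0 : v 0 = laurentCoeff T m q k := by simp [hv, thetaTerm, binom2_zero]
  rw [← hv0, ← h5, ← h1.tsum_sub h2]
  refine tsum_congr fun s => ?_
  have hrec : k + T * s ≠ m - T → v s - v (s + 1) =
      thetaTerm (q ^ T) X s * recursionTerm T m q (k + T * s) := by
    intro hne
    have hX' : -X * (q ^ T) ^ s = (-1) ^ T * q ^ ((T - 1) * m + 1 + (k + T * s)) := by
      rw [hX, zpow_add_one₀ (by norm_num), zpow_add₀ hq0 _ (k + T * s), zpow_add₀ hq0 k, zpow_mul]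
      ring
    rw [← laurentCoeff_recursion hq0 hq1 hT hne, hv]
    simp only
    rw [thetaTerm_add_one hqT hX0, hX', show k + T * (s + 1) = k + T * s + T by ring]
    ring
  rcases sg2_cases k s with ⟨hk, hs, h⟩ | ⟨hk, hs, h⟩ | ⟨-, h⟩
  · rw [← mul_sub, hrec, mul_assoc]
    nlinarith
  · rw [← mul_sub, hrec, mul_assoc]
    nlinarith
  · simp [h]

/-- The Appell-type half of `ℓ` in terms of Hecke-type sums. -/
theorem Theta_mul_appell {q x : ℂ} (hq0 : q ≠ 0) (hq1 : ‖q‖ < 1) (hx0 : x ≠ 0)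
    (hx : ∀ n : ℤ, x ≠ q ^ n) {T : ℤ} (hT : 2 ≤ T) {m : ℤ} (hm0 : 0 ≤ m) (hm1 : m ≤ T - 1) :
    Theta x q * ∑' p : ℤ × ℤ, sg2 p.1 p.2 * appellCoeff T m q p.1 p.2 / (1 - x * q ^ p.1) =
      (-1) ^ (T + 1) * q ^ ((1 - m) * (1 - T)) *
        hecke 1 T (T * (T - 1)) (q ^ m) (-q ^ (binom2 T + T - 1)) q *
        hecke 1 1 T (x⁻¹ * q) ((-1) ^ (T + 1) * q ^ ((T - 1) * m + 1)) q +
      ∑ i ∈ Finset.Icc (0 : ℤ) (T - 2), (-1) ^ i * q ^ (binom2 (i + 1) + m * i) *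
        Theta (-q ^ (binom2 T + T - 1 + T * i)) (q ^ (T * (T - 1))) *
        triple 1 1 T 1 T 1 (x⁻¹ * q) ((-1) ^ (T + 1) * q ^ ((T - 1) * m + 1)) (q ^ (i + 1)) q := by
  set y : ℂ := (-1) ^ (T + 1) * q ^ ((T - 1) * m + 1) with hy
  have hy0 : y ≠ 0 := mul_ne_zero (zpow_ne_zero _ (by norm_num)) (zpow_ne_zero _ hq0)
  have hqx : q / x = x⁻¹ * q := by rw [div_eq_mul_inv, mul_comm]
  have hqx0 : x⁻¹ * q ≠ 0 := mul_ne_zero (inv_ne_zero hx0) hq0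
  have hT0 : 0 < T := by omega
  have hs := summable_norm_heckeTerm hq0 hq1 hqx0 hy0 one_pos zero_le_one hT0
  have h1 : HasSum (heckeTerm 1 1 T (x⁻¹ * q) y q) (hecke 1 1 T (x⁻¹ * q) y q) :=
    hs.of_norm.hasSum
  have h2 : ∀ i : ℤ, HasSum (fun p : ℤ × ℤ => heckeTerm 1 1 T (x⁻¹ * q) y q p *
      partialTheta q (i + 1 + p.1 + T * p.2)) (triple 1 1 T 1 T 1 (x⁻¹ * q) y (q ^ (i + 1)) q) := by
    intro i
    rw [triple_eq_tsum hq0 hq1 hqx0 hy0 hT0]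
    exact (summable_mul_partialTheta hq0 hq1 hs fun p => i + 1 + p.1 + T * p.2).hasSum
  have h3 : HasSum (fun p : ℤ × ℤ => heckeTerm 1 1 T (x⁻¹ * q) y q p *
      recursionTerm T m q (p.1 + T * p.2))
      ((-1) ^ (T + 1) * q ^ ((1 - m) * (1 - T)) *
        hecke 1 T (T * (T - 1)) (q ^ m) (-q ^ (binom2 T + T - 1)) q *
        hecke 1 1 T (x⁻¹ * q) y q +
      ∑ i ∈ Finset.Icc (0 : ℤ) (T - 2), (-1) ^ i * q ^ (binom2 (i + 1) + m * i) *
        Theta (-q ^ (binom2 T + T - 1 + T * i)) (q ^ (T * (T - 1))) *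
        triple 1 1 T 1 T 1 (x⁻¹ * q) y (q ^ (i + 1)) q) := by
    convert! (h1.mul_left _).add (hasSum_sum fun i (_ : i ∈ Finset.Icc (0 : ℤ) (T - 2)) =>
      (h2 i).mul_left ((-1) ^ i * q ^ (binom2 (i + 1) + m * i) *
        Theta (-q ^ (binom2 T + T - 1 + T * i)) (q ^ (T * (T - 1))))) using 1
    funext p
    rw [recursionTerm, mul_add, mul_comm, Finset.mul_sum]
    congr 1
    refine Finset.sum_congr rfl fun i _ => ?_
    rw [← add_assoc]
    ring
  rw [Theta_mul_tsum_div hq0 hq1 hx0 hx (summable_norm_sg2_mul_appellCoeff hq0 hq1 hT m),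
    ← h3.tsum_eq, h3.summable.tsum_prod]
  refine tsum_congr fun k => ?_
  rw [hqx]
  change thetaTerm q (x⁻¹ * q) k * laurentCoeff T m q k = _
  rw [laurentCoeff_eq_tsum hq0 hq1 hT hm0 hm1, ← tsum_mul_left]
  refine tsum_congr fun s => ?_
  rw [heckeTerm_eq_thetaTerm hq0]
  ring

/-! ### Folding the Hecke-Appell series -/

theorem sg2_mul_eq_indicator (p : ℤ × ℤ) (f : ℤ × ℤ → ℂ) :
    sg2 p.1 p.2 * f p = nonnegPairs.indicator f p - negPairs.indicator f p := by
  have h1 : p ∈ nonnegPairs ↔ 0 ≤ p.1 ∧ 0 ≤ p.2 := Iff.rfl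
  have h2 : p ∈ negPairs ↔ p.1 < 0 ∧ p.2 < 0 := Iff.rfl
  simp only [Set.indicator, h1, h2]
  rcases sg2_cases p.1 p.2 with ⟨hr, hs, h⟩ | ⟨hr, hs, h⟩ | ⟨hrs, h⟩
  · simp [h, hr, hs, hr.not_gt]
  · simp [h, hr, hs, hr.not_ge]
  · rw [if_neg (by omega), if_neg (by omega), h]
    simp

theorem ellSummable_of_summable {t m : ℤ} {x q : ℂ}
    (h : Summable fun p : ℤ × ℤ => sg2 p.1 p.2 * ellTerm t m x q p) : EllSummable t m x q := by
  set g := ellTerm t m x q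
  have h1 : Summable (nonnegPairs.indicator g) := by
    convert! h.indicator nonnegPairs using 1
    refine Set.indicator_congr fun p hp => ?_
    rw [sg2_mul_eq_indicator p g, Set.indicator_of_mem hp,
      Set.indicator_of_notMem fun h => h.1.not_ge hp.1, sub_zero]
  have h2 : Summable (negPairs.indicator g) := by
    convert! (h.indicator negPairs).neg using 1
    rw [← Set.indicator_neg]
    refine Set.indicator_congr fun p hp => ?_
    rw [sg2_mul_eq_indicator p g, Set.indicator_of_mem hp,
      Set.indicator_of_notMem fun h => hp.1.not_ge h.1, zero_sub, neg_neg]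
  have h3 := summable_subtype_iff_indicator.mpr h1
  have h4 := summable_subtype_iff_indicator.mpr h2
  exact ⟨h3, h4⟩

theorem ell_eq_tsum {t m : ℤ} {x q : ℂ} (h : EllSummable t m x q) :
    ell t m x q = ∑' p : ℤ × ℤ, sg2 p.1 p.2 * ellTerm t m x q p := by
  set g := ellTerm t m x q with hg
  obtain ⟨h1, h2⟩ : (Summable fun p : nonnegPairs => g p) ∧ Summable fun p : negPairs => g p := h
  replace h1 := (summable_subtype_iff_indicator (f := g)).mp h1
  replace h2 := (summable_subtype_iff_indicator (f := g)).mp h2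
  rw [ell, ← hg, tsum_subtype _ g, tsum_subtype _ g, ← h1.tsum_sub h2]
  exact tsum_congr fun p => (sg2_mul_eq_indicator p g).symm

theorem appellCoeff_neg {q : ℂ} (hq0 : q ≠ 0) (T m r s : ℤ) :
    appellCoeff T m q (-r) (-1 - s) = appellCoeff T m q r s *
      q ^ ((T - 2 * m) * r + 2 * binom2 (T - 1) * s + binom2 (T - 1)) * (q ^ r)⁻¹ := by
  have hs : (-1 : ℂ) ^ (-r) = (-1) ^ r := by
    rw [zpow_neg, ← inv_zpow, inv_neg_one]
  rw [appellCoeff, appellCoeff, hs, ← zpow_neg, mul_assoc ((-1 : ℂ) ^ r),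
    mul_assoc ((-1 : ℂ) ^ r), ← zpow_add₀ hq0, ← zpow_add₀ hq0]
  congr 2
  have h3 := two_mul_binom2 T
  have h4 := two_mul_binom2 (T - 1)
  have h5 : binom2 (-1 - s) = binom2 s + 2 * s + 1 := by
    have h5 := two_mul_binom2 (-1 - s)
    have h6 := two_mul_binom2 s
    linarith
  have h6 : binom2 (T - 1) = binom2 T - (T - 1) := by linarith
  rw [h5, h6, binom2_neg]
  linear_combination (-(s : ℤ) * 2 - 1) * h3

theorem sg2_neg (r s : ℤ) : sg2 (-r) (-1 - s) = (if r = 0 then 1 else 0) - sg2 r s := by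
  simp only [sg2, sg]
  split_ifs <;> first | omega | norm_num

/-- The reflection `(r, s) ↦ (-r, -1 - s)` exchanges the two halves of `ℓ`, together with `x` and
`x⁻¹`, up to the row `r = 0`. -/
theorem hasSum_sg2_mul_ellTerm {q x : ℂ} (hq0 : q ≠ 0) (hq1 : ‖q‖ < 1) (hx0 : x ≠ 0)
    (hx : ∀ n : ℤ, x ≠ q ^ n) {t : ℤ} (ht : 1 ≤ t) (m : ℤ) :
    HasSum (fun p : ℤ × ℤ => sg2 p.1 p.2 * ellTerm t m x q p)
      ((∑' p : ℤ × ℤ, sg2 p.1 p.2 * appellCoeff (3 * t) m q p.1 p.2 / (1 - x * q ^ p.1)) -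
        x⁻¹ * (∑' p : ℤ × ℤ, sg2 p.1 p.2 * appellCoeff (3 * t) m q p.1 p.2 /
          (1 - x⁻¹ * q ^ p.1)) -
        Theta (-q ^ binom2 (3 * t - 1)) (q ^ (3 * t * (3 * t - 1))) / (1 - x)) := by
  have hT : 2 ≤ 3 * t := by omega
  have hE := summable_norm_sg2_mul_appellCoeff hq0 hq1 hT m
  have hth := hasSum_appellCoeff hq0 hq1 hT m 0
  have hbeta : Theta (-q ^ (binom2 (3 * t) + 3 * t - 1)) (q ^ (3 * t * (3 * t - 1))) =
      Theta (-q ^ binom2 (3 * t - 1)) (q ^ (3 * t * (3 * t - 1))) := by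
    rw [← Theta_symm (zpow_ne_zero _ hq0) (neg_ne_zero.mpr (zpow_ne_zero _ hq0)), div_neg,
      ← zpow_sub₀ hq0]
    congr 3
    have h1 := two_mul_binom2 (3 * t)
    have h2 := two_mul_binom2 (3 * t - 1)
    linarith
  simp only [zero_add, binom2_one, mul_zero, add_zero, zpow_zero, one_mul, hbeta] at hth
  have h1 := (summable_div_one_sub hq0 hq1 hx0 hE).hasSum
  have h2 := (summable_div_one_sub hq0 hq1 (inv_ne_zero hx0) hE).hasSum
  have h3 := ((h2.mul_left x⁻¹).add ((hasSum_ite_fst hth 0).div_const (1 - x)))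
  have h4 := h1.sub
    (((Equiv.neg ℤ).prodCongr (Equiv.subLeft (-1 : ℤ))).hasSum_iff.mpr h3)
  convert! h4 using 1
  · funext p
    obtain ⟨r, s⟩ := p
    have hden : 1 - x * q ^ r ≠ 0 := by
      intro h
      refine hx (-r) ?_
      rw [zpow_neg]
      exact eq_inv_of_mul_eq_one_left (sub_eq_zero.mp h).symm
    have hqr : q ^ r ≠ 0 := zpow_ne_zero r hq0
    have hell : ellTerm t m x q (r, s) = appellCoeff (3 * t) m q r s *
        (1 - q ^ ((3 * t - 2 * m) * r + 2 * binom2 (3 * t - 1) * s + binom2 (3 * t - 1))) /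
        (1 - x * q ^ r) := rfl
    simp only [Function.comp_apply, Equiv.prodCongr_apply, Prod.map, Equiv.neg_apply,
      Equiv.subLeft_apply, neg_eq_zero]
    have hden' : x⁻¹ / (1 - x⁻¹ * q ^ (-r)) = -(q ^ r / (1 - x * q ^ r)) := by
      have : 1 - x⁻¹ * q ^ (-r) = -(1 - x * q ^ r) * (x * q ^ r)⁻¹ := by
        rw [zpow_neg]
        field_simp
        ring
      rw [this]
      field_simp
    have hrow : (if r = 0 then appellCoeff (3 * t) m q 0 (-1 - s) else 0) / (1 - x) =
        (if r = 0 then 1 else 0) * (appellCoeff (3 * t) m q (-r) (-1 - s) *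
          (q ^ r / (1 - x * q ^ r))) := by
      split_ifs with h
      · simp [h, div_eq_mul_inv]
      · simp
    rw [hrow, hell, sg2_neg]
    have hcomb : x⁻¹ * (((if r = 0 then 1 else 0) - sg2 r s) *
        appellCoeff (3 * t) m q (-r) (-1 - s) / (1 - x⁻¹ * q ^ (-r))) =
        ((if r = 0 then 1 else 0) - sg2 r s) * appellCoeff (3 * t) m q (-r) (-1 - s) *
          (x⁻¹ / (1 - x⁻¹ * q ^ (-r))) := by ring
    rw [hcomb, hden', appellCoeff_neg hq0]
    field_simp
    ring
  · ring

end MixedFalseTheta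

theorem theorem1p4 (q x : ℂ) (hq0 : q ≠ 0) (hq1 : ‖q‖ < 1)
    (hx0 : x ≠ 0) (hx : ∀ n : ℤ, x ≠ q ^ n)
    (t m : ℤ) (ht : 1 ≤ t) (hm0 : 0 ≤ m) (hm1 : m ≤ 3 * t - 1) :
    -- all the series involved converge absolutely
    (MixedFalseTheta.EllSummable t m x q ∧
      Summable (MixedFalseTheta.heckeTerm 1 (3 * t) (3 * t * (3 * t - 1))
        (q ^ m) (-q ^ (MixedFalseTheta.binom2 (3 * t) + 3 * t - 1)) q) ∧
      Summable (MixedFalseTheta.heckeTerm 1 1 (3 * t)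
        (x⁻¹ * q) ((-1) ^ (t + 1) * q ^ (3 * t * m - m + 1)) q) ∧
      Summable (MixedFalseTheta.heckeTerm 1 1 (3 * t)
        (x * q) ((-1) ^ (t + 1) * q ^ (3 * t * m - m + 1)) q) ∧
      ∀ i : ℤ, 0 ≤ i → i ≤ 3 * t - 2 →
        MixedFalseTheta.TripleSummable 1 1 (3 * t) 1 (3 * t) 1
          (x⁻¹ * q) ((-1) ^ (t + 1) * q ^ (3 * m * t + 1 - m)) (q ^ (i + 1)) q ∧
        MixedFalseTheta.TripleSummable 1 1 (3 * t) 1 (3 * t) 1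
          (x * q) ((-1) ^ (t + 1) * q ^ (3 * m * t + 1 - m)) (q ^ (i + 1)) q) ∧
    -- the identity
    MixedFalseTheta.V t m x q =
      (1 - x) * (-1) ^ (t + 1) * q ^ ((1 - m) * (1 - 3 * t)) / MixedFalseTheta.qPoch q q ^ 2 *
        MixedFalseTheta.hecke 1 (3 * t) (3 * t * (3 * t - 1))
          (q ^ m) (-q ^ (MixedFalseTheta.binom2 (3 * t) + 3 * t - 1)) q *
        (MixedFalseTheta.hecke 1 1 (3 * t)
            (x⁻¹ * q) ((-1) ^ (t + 1) * q ^ (3 * t * m - m + 1)) q / MixedFalseTheta.Theta x q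
          - x⁻¹ * MixedFalseTheta.hecke 1 1 (3 * t)
            (x * q) ((-1) ^ (t + 1) * q ^ (3 * t * m - m + 1)) q / MixedFalseTheta.Theta x⁻¹ q)
      + (1 - x) / MixedFalseTheta.qPoch q q ^ 2 *
        ∑ i ∈ Finset.Icc (0 : ℤ) (3 * t - 2),
          (-1) ^ i * q ^ (MixedFalseTheta.binom2 (i + 1) + m * i) *
          MixedFalseTheta.Theta
            (-q ^ (MixedFalseTheta.binom2 (3 * t) + 3 * t - 1 + 3 * t * i))
            (q ^ (3 * t * (3 * t - 1))) *
          (MixedFalseTheta.triple 1 1 (3 * t) 1 (3 * t) 1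
              (x⁻¹ * q) ((-1) ^ (t + 1) * q ^ (3 * m * t + 1 - m)) (q ^ (i + 1)) q
              / MixedFalseTheta.Theta x q
            - x⁻¹ * MixedFalseTheta.triple 1 1 (3 * t) 1 (3 * t) 1
              (x * q) ((-1) ^ (t + 1) * q ^ (3 * m * t + 1 - m)) (q ^ (i + 1)) q
              / MixedFalseTheta.Theta x⁻¹ q)
      - MixedFalseTheta.Theta (-q ^ MixedFalseTheta.binom2 (3 * t - 1))
          (q ^ (3 * t * (3 * t - 1))) / MixedFalseTheta.qPoch q q ^ 2 := by

  have hT : 2 ≤ 3 * t := by omega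
  have hT0 : 0 < 3 * t := by omega
  have hxi0 : x⁻¹ ≠ 0 := inv_ne_zero hx0
  have hxi : ∀ n : ℤ, x⁻¹ ≠ q ^ n := fun n h => hx (-n) (by rw [zpow_neg, ← h, inv_inv])
  have hsgn : (-1 : ℂ) ^ (t + 1) = (-1) ^ (3 * t + 1) := by
    rw [show 3 * t + 1 = t + 1 + 2 * t by ring, zpow_add₀ (by norm_num) (t + 1), zpow_mul]
    simp
  -- `3 t` and `t` have the same parity, so the general lemmas apply with `T = 3 t`.
  rw [hsgn, show 3 * t * m - m + 1 = (3 * t - 1) * m + 1 by ring,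
    show 3 * m * t + 1 - m = (3 * t - 1) * m + 1 by ring]
  have hA := MixedFalseTheta.Theta_mul_appell hq0 hq1 hx0 hx hT hm0 hm1
  have hB := MixedFalseTheta.Theta_mul_appell hq0 hq1 hxi0 hxi hT hm0 hm1
  have hell := MixedFalseTheta.hasSum_sg2_mul_ellTerm hq0 hq1 hx0 hx ht m
  have hes := MixedFalseTheta.ellSummable_of_summable hell.summable
  have hthA := MixedFalseTheta.Theta_ne_zero hq0 hq1 hx
  have hthB := MixedFalseTheta.Theta_ne_zero hq0 hq1 hxi
  have hx1 : 1 - x ≠ 0 := sub_ne_zero.mpr fun h => hx 0 (by rw [← h, zpow_zero])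
  have hP := MixedFalseTheta.qPoch_self_ne_zero hq1
  rw [inv_inv] at hB
  have hy0 : (-1 : ℂ) ^ (3 * t + 1) * q ^ ((3 * t - 1) * m + 1) ≠ 0 :=
    mul_ne_zero (zpow_ne_zero _ (by norm_num)) (zpow_ne_zero _ hq0)
  have hX : x⁻¹ * q ≠ 0 := mul_ne_zero hxi0 hq0
  have hX' : x * q ≠ 0 := mul_ne_zero hx0 hq0
  refine ⟨⟨hes, ?_, ?_, ?_, fun i _ _ => ⟨?_, ?_⟩⟩, ?_⟩
  · exact (MixedFalseTheta.summable_norm_heckeTerm hq0 hq1 (zpow_ne_zero _ hq0)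
      (neg_ne_zero.mpr (zpow_ne_zero _ hq0)) one_pos hT0.le
      (mul_pos hT0 (by omega))).of_norm
  · exact (MixedFalseTheta.summable_norm_heckeTerm hq0 hq1 hX hy0 one_pos zero_le_one hT0).of_norm
  · exact (MixedFalseTheta.summable_norm_heckeTerm hq0 hq1 hX' hy0 one_pos zero_le_one hT0).of_norm
  · exact MixedFalseTheta.tripleSummable hq0 hq1 hX hy0 (zpow_ne_zero _ hq0) one_pos zero_le_one
      hT0 zero_le_one hT0.le one_pos
  · exact MixedFalseTheta.tripleSummable hq0 hq1 hX' hy0 (zpow_ne_zero _ hq0) one_pos zero_le_one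
      hT0 zero_le_one hT0.le one_pos
  rw [MixedFalseTheta.V, MixedFalseTheta.ell_eq_tsum hes, hell.tsum_eq,
    eq_div_of_mul_eq hthA ((mul_comm _ _).trans hA),
    eq_div_of_mul_eq hthB ((mul_comm _ _).trans hB)]
  simp only [mul_sub, Finset.sum_sub_distrib, ← mul_div_assoc, ← Finset.sum_div]
  simp only [mul_left_comm _ x⁻¹, ← Finset.mul_sum]
  field_simp
  ring
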